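/- **Setting (continuous problem).** Let $\Omega=(0,L_x)\times(0,L_y)\times(0,L_z)$ and let $\varepsilon,\gamma,T>0$. Let $(\phi_e,\mu_e,p_e,\boldsymbol u_e)$ be a classical solution of the Cahn–Hilliard–Hele–Shaw system $$\partial_t\phi=\Delta\mu-\nabla\cdot(\phi\boldsymbol u),\quad \boldsymbol u=-\nabla p-\gamma\phi\nabla\mu,\quad \nabla\cdot\boldsymbol u=0,\quad \mu=\phi^3-\phi-\varepsilon^2\Delta\phi\quad\text{in }\Omega\times(0,T),$$ with $\partial_n\phi=\partial_n\mu=\partial_np=0$ on $\partial\Omega\times(0,T]$, where $\phi_e\in H^3(0,T;C^0(\overline\Omega))\cap H^2(0,T;C^4(\overline\Omega))\cap L^\infty(0,T;C^6(\overline\Omega))$ (identified with its representative that is continuous on $[0,T]\times\overline\Omega$). **Setting (scheme).** Let $h=L_x/N_x=L_y/N_y=L_z/N_z$ with positive integers $N_x,N_y,N_z$, let $s=T/M$ with a positive integer $M$, and $t_m=ms$. Cell-centred grid functions live at the points $((i-\frac12)h,(j-\frac12)h,(k-\frac12)h)$, $1\le i\le N_x$, $1\le j\le N_y$, $1\le k\le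 N_z$, with one layer of ghost points; discrete homogeneous Neumann conditions mean that each ghost value equals the value in the adjacent cell. $\nabla_h$ (cell to face differences), $\nabla_h\cdot$ (face to cell differences), $\Delta_h=\nabla_h\cdot\nabla_h$ (extended to the ghost points by the Neumann condition) and $A_h$ (averages of the two adjacent cells, on faces) are the standard operators on the staggered grid. Further, $\|\phi\|_\infty=\max_{i,j,k}|\phi_{i,j,k}|$, and $\|\nabla_h\phi\|_2^2=\sum_d\frac{h^3}{2}\sum_{\text{cells}}\big(f_{d,+}^2+f_{d,-}^2\big)$, where $f_{d,\pm}$ are the values of the component $d$ of $\nabla_h\phi$ on the two faces of the cell orthogonal to direction $d$. Let $\Phi^m$ be the grid function of the values of $\phi_e(\cdot,t_m)$ at the cell centres, with Neumann ghost values. Let $\phi^0=\Phi^0$, $\phi^1=\Phi^1$, and for $1\le m\le M-1$ let $(\phi^{m+1},\mu^{m+1/2},p^{m+1/2})$, with discrete homogeneous Neumann conditions, solve $$\phi^{m+1}-\phi^m=s\nabla_h\cdot\big((1+\gamma(A_h\phi_*^{m+1/2})^2)\nabla_h\mu^{m+1/2}\big)+s\nabla_h\cdot\big(A_h\phi_*^{m+1/2}\nabla_hp^{m+1/2}\big),$$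 $$\mu^{m+1/2}=\tfrac14\big((\phi^{m+1})^2+(\phi^m)^2\big)(\phi^{m+1}+\phi^m)-\phi_*^{m+1/2}-\varepsilon^2\Delta_h\big(\tfrac34\phi^{m+1}+\tfrac14\phi^{m-1}\big),$$ $$\Delta_hp^{m+1/2}=-\gamma\nabla_h\cdot\big(A_h\phi_*^{m+1/2}\nabla_h\mu^{m+1/2}\big),\qquad \phi_*^{m+1/2}=\tfrac32\phi^m-\tfrac12\phi^{m-1}.$$ Put $\tilde\phi^m=\Phi^m-\phi^m$, $M_0^m=\|\phi^m\|_\infty$, and $$D_1^{m+1}=\big((M_0^m)^{16/3}+(M_0^{m-1})^{16/3}\big)\big((M_0^{m+1})^{8/3}+(M_0^m)^{8/3}+1\big)+1,$$ $$D_2^{m+1}=\big((M_0^m)^4+(M_0^{m-1})^4+1\big)\big((M_0^{m+1})^4+(M_0^m)^4+1\big).$$ **Theorem.** Let $C_{29},C_{30},C_{32},C_{33}>0$ be constants that do not depend on $s$ and $h$ (they may depend on $T$, $\Omega$, $\varepsilon$, $\gamma$ and the exact solution). Then there are $s_0,h_0>0$ such that for all $N_x,N_y,N_z,M$ as above with $h\le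 h_0$ and $s\le s_0$, for every solution of the scheme as above and every $2\le m\le M-1$: if $$\|\nabla_h\tilde\phi^k\|_2^2+\varepsilon^2s\sum_{j=1}^k\|\nabla_h\Delta_h\tilde\phi^j\|_2^2\le C_{32}\exp\big(C_{33}(t_k+1)\big)(s^4+h^4)\qquad\text{for all }1\le k\le m,$$ then $$s\big(C_{29}D_1^{m+1}+C_{30}D_2^{m+1}\big)\le\tfrac12 .$$ -/

import Mathlib

open MeasureTheory Set
open scoped NNReal ENNReal ContDiff

namespace CHHS

noncomputable section

/-! ### The continuous problem on the cuboid `Ω = (0, L₀) × (0, L₁) × (0, L₂)` -/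

/-- Points of `ℝ³`. -/
abbrev Pt : Type := Fin 3 → ℝ

/-- The open cuboid `Ω`. -/
def Om (L : Pt) : Set Pt := {x | ∀ d, 0 < x d ∧ x d < L d}

/-- The closed cuboid (the closure of `Ω`). -/
abbrev OmBar (L : Pt) : Set Pt := Set.Icc (0 : Pt) L

/-- Partial derivative in the coordinate direction `d`. -/
def pd (d : Fin 3) (f : Pt → ℝ) (x : Pt) : ℝ := fderiv ℝ f x (Pi.single d 1)

/-- The Laplacian. -/
def lap (f : Pt → ℝ) (x : Pt) : ℝ := ∑ d, pd d (pd d f) x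

/-- The divergence of a vector field. -/
def dive (F : Pt → Fin 3 → ℝ) (x : Pt) : ℝ := ∑ d, pd d (fun y => F y d) x

/-- `∂f/∂n = 0` on `∂Ω`: on the two faces orthogonal to the direction `d`, the (one-sided)
derivative of `f` in the direction `d` vanishes. -/
def NormalDerivZero (L : Pt) (f : Pt → ℝ) : Prop :=
  ∀ x ∈ OmBar L, ∀ d : Fin 3, (x d = 0 ∨ x d = L d) →
    fderivWithin ℝ f (OmBar L) x (Pi.single d 1) = 0

/-- `f ∈ C²(Ω) ∩ C¹(Ω̄)`. -/
def ClassicalReg (L : Pt) (f : Pt → ℝ) : Prop :=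
  ContDiffOn ℝ 2 f (Om L) ∧ ContDiffOn ℝ 1 f (OmBar L)

/-- `(φ, μ, p, u)` is a classical solution of the Cahn-Hilliard-Hele-Shaw system
`∂ₜφ = Δμ - ∇·(φu)`, `u = -∇p - γφ∇μ`, `∇·u = 0`, `μ = φ³ - φ - ε²Δφ` in `Ω × (0,T)`
with `∂φ/∂n = ∂μ/∂n = ∂p/∂n = 0` on `∂Ω × (0,T]`. -/
structure IsCHHSSolution (L : Pt) (ε γ T : ℝ) (φ μ p : ℝ → Pt → ℝ)
    (u : ℝ → Pt → Fin 3 → ℝ) : Prop where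
  reg_phi : ∀ t ∈ Ioc 0 T, ClassicalReg L (φ t)
  reg_mu : ∀ t ∈ Ioc 0 T, ClassicalReg L (μ t)
  reg_p : ∀ t ∈ Ioc 0 T, ClassicalReg L (p t)
  mass : ∀ t ∈ Ioo 0 T, ∀ x ∈ Om L,
    HasDerivAt (fun τ => φ τ x)
      (lap (μ t) x - dive (fun y d => φ t y * u t y d) x) t
  darcy : ∀ t ∈ Ioo 0 T, ∀ x ∈ Om L, ∀ d,
    u t x d = - pd d (p t) x - γ * φ t x * pd d (μ t) x
  incompressible : ∀ t ∈ Ioo 0 T, ∀ x ∈ Om L, dive (u t) x = 0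
  chem : ∀ t ∈ Ioc 0 T, ∀ x ∈ Om L,
    μ t x = (φ t x) ^ 3 - φ t x - ε ^ 2 * lap (φ t) x
  bc_phi : ∀ t ∈ Ioc 0 T, NormalDerivZero L (φ t)
  bc_mu : ∀ t ∈ Ioc 0 T, NormalDerivZero L (μ t)
  bc_p : ∀ t ∈ Ioc 0 T, NormalDerivZero L (p t)

/-! ### The regularity class `H³(0,T;C⁰) ∩ H²(0,T;C⁴) ∩ L^∞(0,T;C⁶)` -/

/-- `v ∈ L^q(0,T; C^k(Ω̄))` (Bochner space): for almost every `t` the function `v t` is `C^k` up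
to the boundary of the cuboid, and for each `j ≤ k` the map sending `t` to the `j`-th spatial
derivative of `v t`, an element of the Banach space of continuous functions on `Ω̄` with the
supremum norm, is strongly measurable with finite `L^q` norm. -/
def MemLpCk (L : Pt) (T : ℝ) (q : ℝ≥0∞) (k : ℕ) (v : ℝ → Pt → ℝ) : Prop :=
  (∀ᵐ t ∂(volume.restrict (Ioo 0 T)), ContDiffOn ℝ k (v t) (OmBar L)) ∧
  ∀ j : ℕ, j ≤ k → ∃ J : ℝ → C(OmBar L, ContinuousMultilinearMap ℝ (fun _ : Fin j => Pt) ℝ),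
    (∀ᵐ t ∂(volume.restrict (Ioo 0 T)), ∀ x : OmBar L,
      J t x = iteratedFDerivWithin ℝ j (v t) (OmBar L) x) ∧
    MemLp J q (volume.restrict (Ioo 0 T))

/-- `w` is the weak time derivative of `v` on `(0,T)`. The identity between integrals of
functions with values in `C(Ω̄)` is stated by evaluation at every point of `Ω̄`. -/
def IsWeakTimeDeriv (L : Pt) (T : ℝ) (v w : ℝ → Pt → ℝ) : Prop :=
  ∀ ψ : ℝ → ℝ, ContDiff ℝ ∞ ψ → HasCompactSupport ψ → tsupport ψ ⊆ Ioo 0 T →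
    ∀ x ∈ OmBar L,
      ∫ t in Ioo 0 T, deriv ψ t * v t x = - ∫ t in Ioo 0 T, ψ t * w t x

/-- `v ∈ H^n(0,T; C^k(Ω̄))`: the weak time derivatives of orders `0, …, n` are in
`L²(0,T; C^k(Ω̄))`. -/
def MemHnCk (L : Pt) (T : ℝ) (n k : ℕ) (v : ℝ → Pt → ℝ) : Prop :=
  ∃ w : ℕ → ℝ → Pt → ℝ, w 0 = v ∧ (∀ i ≤ n, MemLpCk L T 2 k (w i)) ∧
    ∀ i < n, IsWeakTimeDeriv L T (w i) (w (i + 1))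

/-- The regularity class. An element of `H³(0,T;C⁰)` has a unique representative that is
continuous on `[0,T] × Ω̄`, and `φ` is that representative, so that its values at each time make
sense. -/
structure RegularityClass (L : Pt) (T : ℝ) (φ : ℝ → Pt → ℝ) : Prop where
  cont : ContinuousOn (fun q : ℝ × Pt => φ q.1 q.2) (Icc 0 T ×ˢ OmBar L)
  h3c0 : MemHnCk L T 3 0 φ
  h2c4 : MemHnCk L T 2 4 φ
  linftyc6 : MemLpCk L T ⊤ 6 φ

/-! ### The staggered grid -/

/-- Cell-centred grid functions. The value `φ c` belongs to the point with coordinates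
`(c d - 1/2) h`. Only cells with `1 ≤ c d ≤ N d` and their ghost neighbours across a boundary
face (where one coordinate is `0` or `N d + 1`) matter. -/
abbrev Grid : Type := (Fin 3 → ℤ) → ℝ

/-- Face-centred vector fields. The value `f d c` belongs to the face between the cells `c` and
`c + e_d`. -/
abbrev Face : Type := Fin 3 → (Fin 3 → ℤ) → ℝ

/-- The unit index vector `e_d`. -/
def e (d : Fin 3) : Fin 3 → ℤ := Pi.single d 1

/-- The interior cells: `1 ≤ c d ≤ N d` in every direction `d`. -/
def cells (N : Fin 3 → ℕ) : Finset (Fin 3 → ℤ) := Finset.Icc (fun _ => 1) (fun d => (N d : ℤ))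

/-- Discrete homogeneous Neumann boundary condition: the value at each ghost point is the value
in the adjacent interior cell. -/
def Neumann (N : Fin 3 → ℕ) (φ : Grid) : Prop :=
  ∀ c ∈ cells N, ∀ d : Fin 3,
    (c d = 1 → φ (c - e d) = φ c) ∧ (c d = N d → φ (c + e d) = φ c)

/-- Fill the ghost points of a grid function by the homogeneous Neumann condition. -/
def ghostFill (N : Fin 3 → ℕ) (φ : Grid) : Grid :=
  fun c => φ (fun d => max 1 (min (c d) (N d)))

/-- The discrete gradient. -/
def grad (h : ℝ) (φ : Grid) : Face := fun d c => (φ (c + e d) - φ c) / h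

/-- The average of the two cells adjacent to a face. -/
def avg (φ : Grid) : Face := fun d c => (φ c + φ (c + e d)) / 2

/-- The discrete divergence. -/
def div (h : ℝ) (f : Face) : Grid := fun c => ∑ d, (f d c - f d (c - e d)) / h

/-- The discrete Laplacian, with ghost values given by the homogeneous Neumann condition. -/
def dlap (N : Fin 3 → ℕ) (h : ℝ) (φ : Grid) : Grid := ghostFill N (div h (grad h φ))

/-- The inner product of face-centred vector fields. -/
def faceInner (N : Fin 3 → ℕ) (h : ℝ) (f g : Face) : ℝ :=
  ∑ d, (1 / 2) * h ^ 3 * ∑ c ∈ cells N, (f d c * g d c + f d (c - e d) * g d (c - e d))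

/-- `‖∇_h φ‖₂²`. -/
def gradNormSq (N : Fin 3 → ℕ) (h : ℝ) (φ : Grid) : ℝ :=
  faceInner N h (grad h φ) (grad h φ)

/-- `‖φ‖_∞`, the maximum of `|φ|` over the cells. -/
def supNorm (N : Fin 3 → ℕ) (φ : Grid) : ℝ := ((cells N).sup (fun c => ‖φ c‖₊) : ℝ≥0)

/-- The grid projection of `v`: the values of `v` at the cell centres, with ghost values given
by the homogeneous Neumann condition. -/
def gridProj (N : Fin 3 → ℕ) (h : ℝ) (v : Pt → ℝ) : Grid :=
  ghostFill N (fun c => v (fun d => ((c d : ℝ) - 1 / 2) * h))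

/-! ### The scheme -/

/-- `χ(φ, ψ) = (φ² + ψ²)(φ + ψ) / 4`. -/
def chi (a b : ℝ) : ℝ := (1 / 4) * (a ^ 2 + b ^ 2) * (a + b)

/-- The extrapolation `φ_*^{m+1/2} = (3/2) φ^m - (1/2) φ^{m-1}`, for `m ≥ 1`. -/
def extrap (φ : ℕ → Grid) (m : ℕ) : Grid := fun c => 3 / 2 * φ m c - 1 / 2 * φ (m - 1) c

/-- `φ⁰, …, φ^M` solve the second order scheme with time step `s` on the grid with `N` cells of
size `h`; `μ m` and `p m` stand for `μ^{m+1/2}` and `p^{m+1/2}`. -/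
structure IsSchemeSolution (N : Fin 3 → ℕ) (h s ε γ : ℝ) (M : ℕ) (φ μ p : ℕ → Grid) :
    Prop where
  bc_phi : ∀ m, m ≤ M → Neumann N (φ m)
  bc_mu : ∀ m, 1 ≤ m → m + 1 ≤ M → Neumann N (μ m)
  bc_p : ∀ m, 1 ≤ m → m + 1 ≤ M → Neumann N (p m)
  step : ∀ m, 1 ≤ m → m + 1 ≤ M → ∀ c ∈ cells N,
    φ (m + 1) c - φ m c =
      s * div h (fun d b => (1 + γ * avg (extrap φ m) d b ^ 2) * grad h (μ m) d b) c
      + s * div h (fun d b => avg (extrap φ m) d b * grad h (p m) d b) c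
  chem : ∀ m, 1 ≤ m → m + 1 ≤ M → ∀ c ∈ cells N,
    μ m c = chi (φ (m + 1) c) (φ m c) - extrap φ m c
      - ε ^ 2 * dlap N h (fun b => 3 / 4 * φ (m + 1) b + 1 / 4 * φ (m - 1) b) c
  pressure : ∀ m, 1 ≤ m → m + 1 ≤ M → ∀ c ∈ cells N,
    dlap N h (p m) c =
      - γ * div h (fun d b => avg (extrap φ m) d b * grad h (μ m) d b) c

/-- The error `φ̃^m = Φ^m - φ^m`, where `Φ^m` is the grid projection of `φe(·, m s)`. -/
def err (N : Fin 3 → ℕ) (h s : ℝ) (φe : ℝ → Pt → ℝ) (φ : ℕ → Grid) (m : ℕ) : Grid :=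
  fun c => gridProj N h (φe (m * s)) c - φ m c

/-- The error bound at the time step `k`. -/
def ErrorBound (N : Fin 3 → ℕ) (h s ε C₃₂ C₃₃ : ℝ) (φe : ℝ → Pt → ℝ) (φ : ℕ → Grid) (k : ℕ) :
    Prop :=
  gradNormSq N h (err N h s φe φ k)
    + ε ^ 2 * s * ∑ j ∈ Finset.Icc 1 k, gradNormSq N h (dlap N h (err N h s φe φ j))
  ≤ C₃₂ * Real.exp (C₃₃ * (k * s + 1)) * (s ^ 4 + h ^ 4)

/-- `D₁^{m+1}` as a function of `a = M₀^{m+1}`, `b = M₀^m`, `c = M₀^{m-1}`. -/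
def growthOne (a b c : ℝ) : ℝ :=
  (b ^ (16 / 3 : ℝ) + c ^ (16 / 3 : ℝ)) * (a ^ (8 / 3 : ℝ) + b ^ (8 / 3 : ℝ) + 1) + 1

/-- `D₂^{m+1}` as a function of `a = M₀^{m+1}`, `b = M₀^m`, `c = M₀^{m-1}`. -/
def growthTwo (a b c : ℝ) : ℝ := (b ^ 4 + c ^ 4 + 1) * (a ^ 4 + b ^ 4 + 1)

end

end CHHS

/-!
The sup norms of `φ^{m-1}`, `φ^m` and `φ^{m+1}` are bounded by a constant that does not depend on
the discretisation (`CHHS.exists_supNorm_bound`); hence so are `D₁^{m+1}` and `D₂^{m+1}`, and a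
small factor `s` makes the sum less than `1/2`.

The analytic tool is the discrete embedding of `H²` in `L^∞`,
`‖f‖_∞² ≤ C ‖Δ_h f‖₂²` for mean-free Neumann grid functions
(`CHHS.exists_sq_le_cellInner_div_grad`). It follows from the expansion of `f` in tensor products of
discrete cosines: the eigenvalues of `-Δ_h` are at least a multiple of `|k|²`, and
`∑_{k ≠ 0} |k|⁻⁴` converges in three dimensions.

*The known values `φ^{m-1}`, `φ^m`.* The error bound controls `‖Δ_h φ̃^k‖₂` without any relation
between `s` and `h` (`CHHS.cellInner_div_grad_self_le`). For `s ≤ h` the inverse inequality gives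
`‖Δ_h φ̃‖₂ ≲ h⁻¹ ‖∇_h φ̃‖₂ ≲ h`; for `h ≤ s` summation by parts gives
`‖Δ_h φ̃‖₂² ≤ ‖∇_h φ̃‖₂ ‖∇_h Δ_h φ̃‖₂ ≲ s² · s^{3/2}`. The scheme conserves the mean, so the embedding
bounds `φ^k` in the sup norm. The regularity of the exact solution enters through
`CHHS.exists_bound_gridProj`: `Φ` and `Δ_h Φ` are bounded up to the boundary.

*The new value `φ^{m+1}`.* Let `w = φ^{m+1} - φ^m`. Testing the mass equation with `μ` gives
`s ‖∇_h μ‖² + (3/4) ε² ‖∇_h w‖² + (1/12) ‖w‖₄⁴ ≤ ⟨w, G⟩`, where `G` depends on old values only and is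
bounded in `L²`: the pressure part is harmless because the discrete velocity is divergence-free, and
the cubic term is monotone. Testing the mass equation with `w` gives
`‖w‖² ≲ s ‖∇_h μ‖ ‖∇_h w‖`. Together these give `‖w‖² = O(s)`, `‖w‖₄⁴ = O(√s)` and
`‖∇_h μ‖ ‖∇_h w‖ = O(1)`. Now the equation for `μ` is tested with `Δ_h w`. Its cubic part satisfies
`‖w³‖² ≤ ‖w‖_∞² ‖w‖₄⁴ ≲ √s ‖Δ_h w‖²` by the embedding, and is absorbed for small `s`. So `‖Δ_h w‖`,
and by the embedding `‖w‖_∞`, is bounded (`CHHS.exists_increment_bound`).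
-/

namespace CHHS

noncomputable section

/-! ### Summation by parts on the staggered grid -/

/-- The inner product of cell-centred grid functions. -/
def cellInner (N : Fin 3 → ℕ) (h : ℝ) (f g : Grid) : ℝ := h ^ 3 * ∑ c ∈ cells N, f c * g c

/-- The normal component of `F` vanishes on every boundary face. -/
def NoFlux (N : Fin 3 → ℕ) (F : Face) : Prop :=
  ∀ c ∈ cells N, ∀ d : Fin 3, (c d = 1 → F d (c - e d) = 0) ∧ (c d = N d → F d c = 0)

lemma mem_cells {N : Fin 3 → ℕ} {c : Fin 3 → ℤ} :
    c ∈ cells N ↔ ∀ d, 1 ≤ c d ∧ c d ≤ N d := by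
  simp [cells, Finset.mem_Icc, Pi.le_def, forall_and]

lemma add_e_mem_cells {N : Fin 3 → ℕ} {c : Fin 3 → ℤ} (hc : c ∈ cells N) {d : Fin 3}
    (hd : c d ≠ N d) : c + e d ∈ cells N := by
  rw [mem_cells] at hc ⊢
  intro d'
  have := hc d'
  by_cases hdd : d' = d
  · subst hdd
    simp only [Pi.add_apply, e, Pi.single_eq_same]
    omega
  · simpa [e, hdd] using this

lemma sub_e_mem_cells {N : Fin 3 → ℕ} {c : Fin 3 → ℤ} (hc : c ∈ cells N) {d : Fin 3}
    (hd : c d ≠ 1) : c - e d ∈ cells N := by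
  rw [mem_cells] at hc ⊢
  intro d'
  have := hc d'
  by_cases hdd : d' = d
  · subst hdd
    simp only [Pi.sub_apply, e, Pi.single_eq_same]
    omega
  · simpa [e, hdd] using this

/-- A sum over the cells may be shifted by one cell in the direction `d` when the terms on the
boundary faces orthogonal to `d` vanish. -/
lemma sum_cells_sub_e {N : Fin 3 → ℕ} {d : Fin 3} {u : Grid}
    (h0 : ∀ c ∈ cells N, c d = 1 → u (c - e d) = 0)
    (h1 : ∀ c ∈ cells N, c d = N d → u c = 0) :
    ∑ c ∈ cells N, u (c - e d) = ∑ c ∈ cells N, u c := by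
  refine Finset.sum_bij_ne_zero (fun c _ _ => c - e d) ?_ ?_ ?_ ?_
  · intro c hc hu
    exact sub_e_mem_cells hc fun h => hu (h0 c hc h)
  · intro a _ _ b _ _ hab
    simpa using hab
  · intro b hb hu
    exact ⟨b + e d, add_e_mem_cells hb fun h => hu (h1 b hb h), by simpa using hu, by simp⟩
  · intros; rfl

/-- Summation by parts. Nothing is assumed of `f` at the ghost points, because `F` vanishes on the
boundary faces. -/
theorem cellInner_div {N : Fin 3 → ℕ} {F : Face} (hF : NoFlux N F) (h : ℝ) (f : Grid) :
    cellInner N h f (div h F) = -faceInner N h (grad h f) F := by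
  have key : ∀ d, ∑ c ∈ cells N, f c * ((F d c - F d (c - e d)) / h) =
      -((1 / 2) * ∑ c ∈ cells N,
        (grad h f d c * F d c + grad h f d (c - e d) * F d (c - e d))) := by
    intro d
    have s1 := sum_cells_sub_e (N := N) (d := d) (u := fun c => f (c + e d) * F d c)
      (fun c hc h => by simp [(hF c hc d).1 h]) (fun c hc h => by simp [(hF c hc d).2 h])
    have s2 := sum_cells_sub_e (N := N) (d := d) (u := fun c => grad h f d c * F d c)
      (fun c hc h => by simp [(hF c hc d).1 h]) (fun c hc h => by simp [(hF c hc d).2 h])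
    simp only [sub_add_cancel] at s1
    rw [Finset.sum_add_distrib, s2]
    have : ∑ c ∈ cells N, f c * ((F d c - F d (c - e d)) / h)
        = (∑ c ∈ cells N, f c * F d c - ∑ c ∈ cells N, f c * F d (c - e d)) / h := by
      rw [← Finset.sum_sub_distrib, Finset.sum_div]
      exact Finset.sum_congr rfl fun c _ => by ring
    rw [this, s1]
    have : ∑ c ∈ cells N, grad h f d c * F d c
        = (∑ c ∈ cells N, f (c + e d) * F d c - ∑ c ∈ cells N, f c * F d c) / h := by
      rw [← Finset.sum_sub_distrib, Finset.sum_div]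
      exact Finset.sum_congr rfl fun c _ => by simp only [grad]; ring
    rw [this]
    ring
  have : ∑ c ∈ cells N, f c * div h F c
      = ∑ d, ∑ c ∈ cells N, f c * ((F d c - F d (c - e d)) / h) := by
    rw [Finset.sum_comm]
    exact Finset.sum_congr rfl fun c _ => by rw [div, Finset.mul_sum]
  rw [cellInner, this, faceInner, Finset.mul_sum, ← Finset.sum_neg_distrib]
  exact Finset.sum_congr rfl fun d _ => by rw [key d]; ring

lemma sum_div_eq_zero {N : Fin 3 → ℕ} {F : Face} (hF : NoFlux N F) {h : ℝ} (hh : h ≠ 0) :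
    ∑ c ∈ cells N, div h F c = 0 := by
  have h1 := cellInner_div hF h (fun _ => 1)
  have h2 : grad h (fun _ : Fin 3 → ℤ => (1 : ℝ)) = 0 := by ext d c; simp [grad]
  rw [h2, cellInner, faceInner] at h1
  simpa [hh] using h1

lemma Neumann.noFlux_grad {N : Fin 3 → ℕ} {f : Grid} (hf : Neumann N f) (h : ℝ) :
    NoFlux N (grad h f) := by
  intro c hc d
  refine ⟨fun hd => ?_, fun hd => ?_⟩
  · simp [grad, (hf c hc d).1 hd]
  · simp [grad, (hf c hc d).2 hd]

lemma NoFlux.add {N : Fin 3 → ℕ} {F G : Face} (hF : NoFlux N F) (hG : NoFlux N G) :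
    NoFlux N (F + G) := fun c hc d =>
  ⟨fun hd => by simp [(hF c hc d).1 hd, (hG c hc d).1 hd],
   fun hd => by simp [(hF c hc d).2 hd, (hG c hc d).2 hd]⟩

lemma NoFlux.mul {N : Fin 3 → ℕ} {F : Face} (hF : NoFlux N F) (A : Face) :
    NoFlux N (A * F) := fun c hc d =>
  ⟨fun hd => by simp [(hF c hc d).1 hd], fun hd => by simp [(hF c hc d).2 hd]⟩

lemma NoFlux.smul {N : Fin 3 → ℕ} {F : Face} (hF : NoFlux N F) (a : ℝ) :
    NoFlux N (a • F) := fun c hc d =>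
  ⟨fun hd => by simp [(hF c hc d).1 hd], fun hd => by simp [(hF c hc d).2 hd]⟩

lemma Neumann.sub {N : Fin 3 → ℕ} {f g : Grid} (hf : Neumann N f) (hg : Neumann N g) :
    Neumann N (f - g) := fun c hc d =>
  ⟨fun hd => by simp [(hf c hc d).1 hd, (hg c hc d).1 hd],
   fun hd => by simp [(hf c hc d).2 hd, (hg c hc d).2 hd]⟩

lemma neumann_const (N : Fin 3 → ℕ) (a : ℝ) : Neumann N (fun _ => a) := by
  intro c _ d; simp

lemma ghostFill_of_mem {N : Fin 3 → ℕ} {c : Fin 3 → ℤ} (hc : c ∈ cells N) (f : Grid) :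
    ghostFill N f c = f c := by
  rw [mem_cells] at hc
  unfold ghostFill
  congr 1
  ext d
  rw [min_eq_left (hc d).2, max_eq_right (hc d).1]

lemma neumann_ghostFill (N : Fin 3 → ℕ) (f : Grid) : Neumann N (ghostFill N f) := by
  intro c hc d
  rw [mem_cells] at hc
  have hd := hc d
  refine ⟨fun h1 => ?_, fun h1 => ?_⟩ <;>
  · unfold ghostFill
    congr 1
    ext d'
    by_cases hdd : d' = d
    · subst hdd
      simp only [Pi.add_apply, Pi.sub_apply, e, Pi.single_eq_same]
      omega
    · simp [e, hdd]

lemma dlap_of_mem {N : Fin 3 → ℕ} {c : Fin 3 → ℤ} (hc : c ∈ cells N) (h : ℝ) (f : Grid) :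
    dlap N h f c = div h (grad h f) c := ghostFill_of_mem hc _

lemma cellInner_congr {N : Fin 3 → ℕ} {h : ℝ} {f f' g g' : Grid}
    (hf : ∀ c ∈ cells N, f c = f' c) (hg : ∀ c ∈ cells N, g c = g' c) :
    cellInner N h f g = cellInner N h f' g' := by
  unfold cellInner
  congr 1
  exact Finset.sum_congr rfl fun c hc => by rw [hf c hc, hg c hc]

lemma cellInner_comm (N : Fin 3 → ℕ) (h : ℝ) (f g : Grid) :
    cellInner N h f g = cellInner N h g f := by
  simp only [cellInner, mul_comm]

lemma cellInner_smul_right (N : Fin 3 → ℕ) (h a : ℝ) (f g : Grid) :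
    cellInner N h f (a • g) = a * cellInner N h f g := by
  simp only [cellInner, Pi.smul_apply, smul_eq_mul, Finset.mul_sum]
  exact Finset.sum_congr rfl fun c _ => by ring

lemma cellInner_sub_right (N : Fin 3 → ℕ) (h : ℝ) (f g g' : Grid) :
    cellInner N h f (g - g') = cellInner N h f g - cellInner N h f g' := by
  simp only [cellInner, Pi.sub_apply, mul_sub, Finset.sum_sub_distrib]

lemma cellInner_mono {N : Fin 3 → ℕ} {h : ℝ} (hh : 0 ≤ h) {f g f' g' : Grid}
    (H : ∀ c ∈ cells N, f c * g c ≤ f' c * g' c) :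
    cellInner N h f g ≤ cellInner N h f' g' :=
  mul_le_mul_of_nonneg_left (Finset.sum_le_sum H) (by positivity)

lemma cellInner_self_nonneg (N : Fin 3 → ℕ) {h : ℝ} (hh : 0 ≤ h) (f : Grid) :
    0 ≤ cellInner N h f f :=
  mul_nonneg (by positivity) (Finset.sum_nonneg fun c _ => mul_self_nonneg _)

theorem cellInner_sq_le (N : Fin 3 → ℕ) (h : ℝ) (f g : Grid) :
    cellInner N h f g ^ 2 ≤ cellInner N h f f * cellInner N h g g := by
  have := Finset.sum_mul_sq_le_sq_mul_sq (cells N) f g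
  simp only [cellInner]
  calc (h ^ 3 * ∑ c ∈ cells N, f c * g c) ^ 2
      = (h ^ 3) ^ 2 * (∑ c ∈ cells N, f c * g c) ^ 2 := by ring
    _ ≤ (h ^ 3) ^ 2 * ((∑ c ∈ cells N, f c ^ 2) * ∑ c ∈ cells N, g c ^ 2) := by gcongr
    _ = _ := by simp only [sq]; ring

lemma cellInner_add_self_le (N : Fin 3 → ℕ) {h : ℝ} (hh : 0 ≤ h) (f g : Grid) :
    cellInner N h (f + g) (f + g) ≤ 2 * cellInner N h f f + 2 * cellInner N h g g := by
  have : 2 * cellInner N h f f + 2 * cellInner N h g g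
      = h ^ 3 * ∑ c ∈ cells N, (2 * (f c * f c) + 2 * (g c * g c)) := by
    simp only [cellInner, Finset.sum_add_distrib, ← Finset.mul_sum]; ring
  rw [this]
  refine mul_le_mul_of_nonneg_left (Finset.sum_le_sum fun c _ => ?_) (by positivity)
  simp only [Pi.add_apply]
  nlinarith [sq_nonneg (f c - g c)]

lemma cellInner_smul_self (N : Fin 3 → ℕ) (h a : ℝ) (f : Grid) :
    cellInner N h (a • f) (a • f) = a ^ 2 * cellInner N h f f := by
  rw [cellInner_smul_right, cellInner_comm, cellInner_smul_right]; ring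

lemma faceInner_comm (N : Fin 3 → ℕ) (h : ℝ) (f g : Face) :
    faceInner N h f g = faceInner N h g f := by
  simp only [faceInner, mul_comm]

lemma faceInner_add_right (N : Fin 3 → ℕ) (h : ℝ) (f g g' : Face) :
    faceInner N h f (g + g') = faceInner N h f g + faceInner N h f g' := by
  simp only [faceInner, ← Finset.sum_add_distrib, ← mul_add]
  refine Finset.sum_congr rfl fun d _ => ?_
  congr 1
  exact Finset.sum_congr rfl fun c _ => by simp only [Pi.add_apply]; ring

lemma faceInner_smul_right (N : Fin 3 → ℕ) (h a : ℝ) (f g : Face) :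
    faceInner N h f (a • g) = a * faceInner N h f g := by
  simp only [faceInner, Finset.mul_sum]
  refine Finset.sum_congr rfl fun d _ => Finset.sum_congr rfl fun c _ => ?_
  simp only [Pi.smul_apply, smul_eq_mul]; ring

lemma faceInner_mul_left (N : Fin 3 → ℕ) (h : ℝ) (A f g : Face) :
    faceInner N h (A * f) g = faceInner N h f (A * g) := by
  simp only [faceInner]
  refine Finset.sum_congr rfl fun d _ => ?_
  congr 1
  refine Finset.sum_congr rfl fun c _ => ?_
  simp only [Pi.mul_apply]; ring

lemma faceInner_self_nonneg (N : Fin 3 → ℕ) {h : ℝ} (hh : 0 ≤ h) (f : Face) :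
    0 ≤ faceInner N h f f :=
  Finset.sum_nonneg fun d _ => mul_nonneg (by positivity)
    (Finset.sum_nonneg fun c _ => add_nonneg (mul_self_nonneg _) (mul_self_nonneg _))

theorem faceInner_sq_le (N : Fin 3 → ℕ) {h : ℝ} (hh : 0 ≤ h) (f g : Face) :
    faceInner N h f g ^ 2 ≤ faceInner N h f f * faceInner N h g g := by
  have H : ∀ x : ℝ, 0 ≤ faceInner N h g g * (x * x) + 2 * faceInner N h f g * x
      + faceInner N h f f := by
    intro x
    have h0 := faceInner_self_nonneg N hh (f + x • g)
    rw [faceInner_add_right, faceInner_smul_right, faceInner_comm N h _ f,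
      faceInner_comm N h _ g, faceInner_add_right, faceInner_add_right, faceInner_smul_right,
      faceInner_smul_right, faceInner_comm N h g f] at h0
    linarith
  have := discrim_le_zero H
  rw [discrim] at this
  nlinarith

lemma faceInner_add_self_le (N : Fin 3 → ℕ) {h : ℝ} (hh : 0 ≤ h) (f g : Face) :
    faceInner N h (f + g) (f + g) ≤ 2 * faceInner N h f f + 2 * faceInner N h g g := by
  have h0 := faceInner_self_nonneg N hh (f + (-1 : ℝ) • g)
  rw [faceInner_add_right, faceInner_smul_right, faceInner_comm N h _ f,
    faceInner_comm N h _ g, faceInner_add_right, faceInner_add_right, faceInner_smul_right,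
    faceInner_smul_right, faceInner_comm N h g f] at h0
  rw [faceInner_add_right, faceInner_comm N h _ f,
    faceInner_comm N h _ g, faceInner_add_right, faceInner_add_right, faceInner_comm N h g f]
  linarith

lemma faceInner_mul_self_le {N : Fin 3 → ℕ} {h K : ℝ} (hh : 0 ≤ h) {A : Face}
    (hA : ∀ c ∈ cells N, ∀ d, |A d c| ≤ K ∧ |A d (c - e d)| ≤ K) (f : Face) :
    faceInner N h (A * f) (A * f) ≤ K ^ 2 * faceInner N h f f := by
  simp only [faceInner, Finset.mul_sum]
  refine Finset.sum_le_sum fun d _ => Finset.sum_le_sum fun c hc => ?_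
  obtain ⟨h1, h2⟩ := hA c hc d
  have h1' : A d c ^ 2 ≤ K ^ 2 := by rw [← sq_abs]; gcongr
  have h2' : A d (c - e d) ^ 2 ≤ K ^ 2 := by rw [← sq_abs (A d (c - e d))]; gcongr
  have h3 := mul_le_mul_of_nonneg_right h1' (sq_nonneg (f d c))
  have h4 := mul_le_mul_of_nonneg_right h2' (sq_nonneg (f d (c - e d)))
  have h5 : 0 ≤ 1 / 2 * h ^ 3 := by positivity
  simp only [Pi.mul_apply]
  calc 1 / 2 * h ^ 3 * (A d c * f d c * (A d c * f d c)
        + A d (c - e d) * f d (c - e d) * (A d (c - e d) * f d (c - e d)))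
      ≤ 1 / 2 * h ^ 3 * (K ^ 2 * f d c ^ 2 + K ^ 2 * f d (c - e d) ^ 2) :=
        mul_le_mul_of_nonneg_left (by linarith) h5
    _ = _ := by ring

/-- Inverse inequality: the discrete Laplacian costs one power of `h` against the gradient. -/
theorem cellInner_div_self_le (N : Fin 3 → ℕ) {h : ℝ} (hh : 0 < h) (F : Face) :
    cellInner N h (div h F) (div h F) ≤ 12 / h ^ 2 * faceInner N h F F := by
  have : 12 / h ^ 2 * faceInner N h F F
      = h ^ 3 * ∑ c ∈ cells N, 6 / h ^ 2 * ∑ d, (F d c ^ 2 + F d (c - e d) ^ 2) := by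
    simp only [faceInner, Finset.mul_sum]
    rw [Finset.sum_comm]
    refine Finset.sum_congr rfl fun c _ => Finset.sum_congr rfl fun d _ => by ring
  rw [this]
  refine mul_le_mul_of_nonneg_left (Finset.sum_le_sum fun c _ => ?_) (by positivity)
  simp only [div, Fin.sum_univ_three]
  generalize F 0 c = a0
  generalize F 1 c = a1
  generalize F 2 c = a2
  generalize F 0 (c - e 0) = b0
  generalize F 1 (c - e 1) = b1
  generalize F 2 (c - e 2) = b2
  have key : ((a0 - b0) + (a1 - b1) + (a2 - b2)) ^ 2
      ≤ 6 * (a0 ^ 2 + b0 ^ 2 + (a1 ^ 2 + b1 ^ 2) + (a2 ^ 2 + b2 ^ 2)) := by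
    nlinarith [sq_nonneg ((a0 - b0) - (a1 - b1)), sq_nonneg ((a0 - b0) - (a2 - b2)),
      sq_nonneg ((a1 - b1) - (a2 - b2)), sq_nonneg (a0 + b0), sq_nonneg (a1 + b1),
      sq_nonneg (a2 + b2)]
  calc _ = ((a0 - b0) + (a1 - b1) + (a2 - b2)) ^ 2 / h ^ 2 := by ring
    _ ≤ 6 * (a0 ^ 2 + b0 ^ 2 + (a1 ^ 2 + b1 ^ 2) + (a2 ^ 2 + b2 ^ 2)) / h ^ 2 := by gcongr
    _ = _ := by ring

/-- The seven-point form of the discrete Laplacian. -/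
lemma div_grad_apply (h : ℝ) (f : Grid) (c : Fin 3 → ℤ) :
    div h (grad h f) c = ∑ d, (f (c + e d) - 2 * f c + f (c - e d)) / h ^ 2 := by
  simp only [div, grad, sub_add_cancel]
  exact Finset.sum_congr rfl fun d _ => by ring

lemma div_add (h : ℝ) (F G : Face) : div h (F + G) = div h F + div h G := by
  ext c
  simp only [div, Pi.add_apply, ← Finset.sum_add_distrib]
  exact Finset.sum_congr rfl fun d _ => by ring

lemma div_smul (h a : ℝ) (F : Face) : div h (a • F) = a • div h F := by
  ext c
  simp only [div, Pi.smul_apply, smul_eq_mul, Finset.mul_sum]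
  exact Finset.sum_congr rfl fun d _ => by ring

lemma grad_add (h : ℝ) (f g : Grid) : grad h (f + g) = grad h f + grad h g := by
  ext d c; simp only [grad, Pi.add_apply]; ring

lemma grad_smul (h a : ℝ) (f : Grid) : grad h (a • f) = a • grad h f := by
  ext d c; simp only [grad, Pi.smul_apply, smul_eq_mul]; ring

lemma div_sub (h : ℝ) (F G : Face) : div h (F - G) = div h F - div h G := by
  ext c
  simp only [div, Pi.sub_apply, ← Finset.sum_sub_distrib]
  exact Finset.sum_congr rfl fun d _ => by ring

lemma grad_sub (h : ℝ) (f g : Grid) : grad h (f - g) = grad h f - grad h g := by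
  ext d c; simp only [grad, Pi.sub_apply]; ring

/-! ### The discrete cosine transform and the embedding of `H²` in `L^∞` -/

/-- The cosine mode `k` on `n` cells, at the centre of the cell `i`. -/
def cosMode (n k : ℕ) (i : ℤ) : ℝ := Real.cos (Real.pi * k / n * (i - 1 / 2))

/-- The inverse of `∑ᵢ (cosMode n k i)²` over the `n` cells, for `k < n`. -/
def cosWeight (n k : ℕ) : ℝ := if k = 0 then 1 / n else 2 / n

/-- The Dirichlet kernel. -/
lemma sin_half_mul_dirichlet (θ : ℝ) (n : ℕ) :
    Real.sin (θ / 2) * (1 + 2 * ∑ k ∈ Finset.range n, Real.cos ((k + 1) * θ))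
      = Real.sin ((n + 1 / 2) * θ) := by
  induction n with
  | zero => simp; ring_nf
  | succ n ih =>
    rw [Finset.sum_range_succ]
    have : Real.sin ((((n + 1 : ℕ) : ℝ) + 1 / 2) * θ) - Real.sin ((n + 1 / 2) * θ)
        = 2 * Real.sin (θ / 2) * Real.cos ((n + 1) * θ) := by
      rw [Real.sin_sub_sin]
      push_cast
      ring_nf
    linear_combination ih - this

lemma dirichlet_at_pi_div {n : ℕ} (m : ℤ) (h0 : 0 < |m|) (h1 : |m| < 2 * (n + 1)) :
    1 + 2 * ∑ k ∈ Finset.range n, Real.cos ((k + 1) * (Real.pi * m / (n + 1)))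
      = -(-1) ^ m := by
  have hn : (0 : ℝ) < n + 1 := by positivity
  have hs : Real.sin (Real.pi * m / (n + 1) / 2) ≠ 0 := by
    rw [Ne, Real.sin_eq_zero_iff]
    rintro ⟨j, hj⟩
    have hj' : (j * (2 * (n + 1)) : ℝ) = m := by
      field_simp at hj
      linarith
    have hj2 : j * (2 * (n + 1)) = m := by exact_mod_cast hj'
    have : (2 * (n + 1) : ℤ) ∣ m := ⟨j, by rw [← hj2]; ring⟩
    have := Int.eq_zero_of_abs_lt_dvd this h1
    simp [this] at h0
  apply mul_left_cancel₀ hs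
  rw [sin_half_mul_dirichlet]
  have : ((n : ℝ) + 1 / 2) * (Real.pi * m / (n + 1))
      = m * Real.pi - Real.pi * m / (n + 1) / 2 := by
    field_simp
    ring
  rw [this, Real.sin_int_mul_pi_sub]
  ring

/-- Completeness of the cosine modes on `n` cells. The sum consists of Dirichlet kernels at `i - j`
and at `i + j - 1`, integers of opposite parity, where the kernels cancel unless `i = j`. -/
theorem sum_cosWeight_mul_cosMode {n : ℕ} {i j : ℤ} (hi : 1 ≤ i ∧ i ≤ n) (hj : 1 ≤ j ∧ j ≤ n) :
    ∑ k ∈ Finset.range n, cosWeight n k * (cosMode n k i * cosMode n k j)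
      = if i = j then 1 else 0 := by
  obtain ⟨n, rfl⟩ : ∃ n', n = n' + 1 := ⟨n - 1, by omega⟩
  have hn : (0 : ℝ) < n + 1 := by positivity
  have hterm : ∀ k : ℕ, cosMode (n + 1) (k + 1) i * cosMode (n + 1) (k + 1) j
      = (Real.cos ((k + 1) * (Real.pi * ((i - j : ℤ) : ℝ) / (n + 1)))
        + Real.cos ((k + 1) * (Real.pi * ((i + j - 1 : ℤ) : ℝ) / (n + 1)))) / 2 := by
    intro k
    have := Real.two_mul_cos_mul_cos
      (Real.pi * ((k + 1 : ℕ) : ℝ) / ((n + 1 : ℕ) : ℝ) * (i - 1 / 2))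
      (Real.pi * ((k + 1 : ℕ) : ℝ) / ((n + 1 : ℕ) : ℝ) * (j - 1 / 2))
    rw [mul_assoc] at this
    simp only [cosMode]
    rw [eq_div_iff two_ne_zero, mul_comm, this]
    push_cast
    congr 2 <;> ring
  rw [Finset.sum_range_succ']
  have h2 : ∑ k ∈ Finset.range n,
      cosWeight (n + 1) (k + 1) * (cosMode (n + 1) (k + 1) i * cosMode (n + 1) (k + 1) j)
      = 1 / (n + 1) * (∑ k ∈ Finset.range n,
          Real.cos ((k + 1) * (Real.pi * ((i - j : ℤ) : ℝ) / (n + 1)))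
        + ∑ k ∈ Finset.range n,
          Real.cos ((k + 1) * (Real.pi * ((i + j - 1 : ℤ) : ℝ) / (n + 1)))) := by
    rw [← Finset.sum_add_distrib, Finset.mul_sum]
    refine Finset.sum_congr rfl fun k _ => ?_
    rw [hterm]
    simp only [cosWeight, Nat.succ_ne_zero, if_false]
    push_cast
    ring
  have h0 : cosWeight (n + 1) 0 * (cosMode (n + 1) 0 i * cosMode (n + 1) 0 j) = 1 / (n + 1) := by
    simp [cosWeight, cosMode]
  push_cast at hi hj
  rw [h2, h0]
  have e2 := dirichlet_at_pi_div (n := n) (i + j - 1) (by rw [abs_pos]; omega)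
    (by rw [abs_lt]; constructor <;> omega)
  by_cases hij : i = j
  · subst hij
    have hodd : (-1 : ℝ) ^ (i + i - 1) = -1 := Odd.neg_one_zpow ⟨i - 1, by ring⟩
    rw [hodd] at e2
    simp only [sub_self, Int.cast_zero, mul_zero, zero_div, Real.cos_zero, Finset.sum_const,
      Finset.card_range, nsmul_eq_mul, mul_one, if_true]
    have : ∑ k ∈ Finset.range n,
          Real.cos ((k + 1) * (Real.pi * ((i + i - 1 : ℤ) : ℝ) / (n + 1))) = 0 := by linarith
    rw [this]
    field_simp
    ring
  · have e1 := dirichlet_at_pi_div (n := n) (i - j) (by rw [abs_pos]; omega)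
      (by rw [abs_lt]; constructor <;> omega)
    have hodd : (-1 : ℝ) ^ (i + j - 1) = -(-1) ^ (i - j) := by
      have : i + j - 1 = (i - j) + (2 * j - 1) := by ring
      rw [this, zpow_add₀ (by norm_num), Odd.neg_one_zpow (n := 2 * j - 1) ⟨j - 1, by ring⟩]
      ring
    rw [hodd] at e2
    rw [if_neg hij]
    have e3 : ∑ k ∈ Finset.range n,
          Real.cos ((k + 1) * (Real.pi * ((i - j : ℤ) : ℝ) / (n + 1)))
        + ∑ k ∈ Finset.range n,
          Real.cos ((k + 1) * (Real.pi * ((i + j - 1 : ℤ) : ℝ) / (n + 1))) = -1 := by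
      linarith
    rw [e3]
    ring

/-- The tensor product of cosine modes, an eigenfunction of the discrete Neumann Laplacian. -/
def cosProd (N k : Fin 3 → ℕ) : Grid := fun c => ∏ d, cosMode (N d) (k d) (c d)

/-- The weight that normalises `cosProd N k`. -/
def prodWeight (N k : Fin 3 → ℕ) : ℝ := ∏ d, cosWeight (N d) (k d)

/-- The set of wave vectors. -/
def modes (N : Fin 3 → ℕ) : Finset (Fin 3 → ℕ) := Fintype.piFinset fun d => Finset.range (N d)

/-- The eigenvalue of minus the discrete Laplacian at the mode `k`. -/
def eigen (N : Fin 3 → ℕ) (h : ℝ) (k : Fin 3 → ℕ) : ℝ :=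
  ∑ d, (2 - 2 * Real.cos (Real.pi * k d / N d)) / h ^ 2

/-- The (unnormalised) cosine coefficient of `f`. -/
def cosCoeff (N : Fin 3 → ℕ) (f : Grid) (k : Fin 3 → ℕ) : ℝ :=
  ∑ c ∈ cells N, cosProd N k c * f c

theorem sum_prodWeight_mul_cosProd {N : Fin 3 → ℕ} {c c' : Fin 3 → ℤ} (hc : c ∈ cells N)
    (hc' : c' ∈ cells N) :
    ∑ k ∈ modes N, prodWeight N k * (cosProd N k c * cosProd N k c')
      = if c = c' then 1 else 0 := by
  rw [mem_cells] at hc hc'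
  simp only [prodWeight, cosProd, ← Finset.prod_mul_distrib]
  rw [modes, ← Finset.prod_univ_sum (fun d => Finset.range (N d))
    (fun d κ => cosWeight (N d) κ * (cosMode (N d) κ (c d) * cosMode (N d) κ (c' d)))]
  rw [Finset.prod_congr rfl fun d _ => sum_cosWeight_mul_cosMode (hc d) (hc' d)]
  by_cases h : c = c'
  · simp [h]
  · rw [if_neg h]
    obtain ⟨d, hd⟩ := Function.ne_iff.1 h
    exact Finset.prod_eq_zero (Finset.mem_univ d) (if_neg hd)

lemma sum_cosCoeff {N : Fin 3 → ℕ} {c : Fin 3 → ℤ} (hc : c ∈ cells N) (f : Grid) :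
    f c = ∑ k ∈ modes N, prodWeight N k * cosProd N k c * cosCoeff N f k := by
  simp only [cosCoeff, Finset.mul_sum]
  rw [Finset.sum_comm]
  have : ∀ c' ∈ cells N, ∑ k ∈ modes N, prodWeight N k * cosProd N k c * (cosProd N k c' * f c')
      = (if c = c' then 1 else 0) * f c' := by
    intro c' hc'
    rw [← sum_prodWeight_mul_cosProd hc hc', Finset.sum_mul]
    exact Finset.sum_congr rfl fun k _ => by ring
  rw [Finset.sum_congr rfl this]
  simp [hc]

/-- Parseval's identity. -/
lemma sum_cosCoeff_sq (N : Fin 3 → ℕ) (f : Grid) :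
    ∑ k ∈ modes N, prodWeight N k * cosCoeff N f k ^ 2 = ∑ c ∈ cells N, f c * f c := by
  have : ∀ k ∈ modes N, prodWeight N k * cosCoeff N f k ^ 2
      = ∑ c ∈ cells N, f c * (prodWeight N k * cosProd N k c * cosCoeff N f k) := by
    intro k _
    rw [sq]
    nth_rewrite 1 [cosCoeff]
    rw [Finset.sum_mul, Finset.mul_sum]
    exact Finset.sum_congr rfl fun c _ => by ring
  rw [Finset.sum_congr rfl this, Finset.sum_comm]
  refine Finset.sum_congr rfl fun c hc => ?_
  rw [← Finset.mul_sum, ← sum_cosCoeff hc]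

lemma neumann_cosProd (N k : Fin 3 → ℕ) : Neumann N (cosProd N k) := by
  intro c hc d
  have hN : (N d : ℝ) ≠ 0 := by
    have := mem_cells.1 hc d
    have : N d ≠ 0 := by omega
    exact_mod_cast this
  have hne : ∀ d', d' ≠ d → e d d' = 0 := fun d' h => by simp [e, h]
  have hs : e d d = 1 := by simp [e]
  refine ⟨fun h1 => ?_, fun h1 => ?_⟩ <;> refine Finset.prod_congr rfl fun d' _ => ?_ <;>
    by_cases hd : d' = d
  · subst hd
    simp only [cosMode, Pi.sub_apply, hs, h1]
    rw [← Real.cos_neg]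
    congr 1
    push_cast
    ring
  · simp [Pi.sub_apply, hne d' hd]
  · subst hd
    simp only [cosMode, Pi.add_apply, hs, h1]
    rw [← Real.cos_neg, ← Real.cos_add_nat_mul_two_pi _ (k d')]
    congr 1
    push_cast
    field_simp
    ring
  · simp [Pi.add_apply, hne d' hd]

lemma cosMode_add_sub (n k : ℕ) (i : ℤ) :
    cosMode n k (i + 1) + cosMode n k (i - 1)
      = 2 * Real.cos (Real.pi * k / n) * cosMode n k i := by
  simp only [cosMode]
  have := Real.two_mul_cos_mul_cos (Real.pi * k / n) (Real.pi * k / n * (i - 1 / 2))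
  rw [this, ← Real.cos_neg (Real.pi * k / n - _), add_comm]
  push_cast
  congr 2 <;> ring

lemma div_grad_cosProd (N k : Fin 3 → ℕ) (h : ℝ) (c : Fin 3 → ℤ) :
    div h (grad h (cosProd N k)) c = -eigen N h k * cosProd N k c := by
  rw [div_grad_apply, eigen, ← Finset.sum_neg_distrib, Finset.sum_mul]
  refine Finset.sum_congr rfl fun d _ => ?_
  have hne : ∀ d' ∈ Finset.univ.erase d, e d d' = 0 := fun d' h => by
    simp [e, Finset.ne_of_mem_erase h]
  have hs : e d d = 1 := by simp [e]
  have h1 : cosProd N k (c + e d) = cosMode (N d) (k d) (c d + 1)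
      * ∏ d' ∈ Finset.univ.erase d, cosMode (N d') (k d') (c d') := by
    rw [cosProd, ← Finset.mul_prod_erase _ _ (Finset.mem_univ d), Pi.add_apply, hs]
    congr 1
    exact Finset.prod_congr rfl fun d' hd' => by rw [Pi.add_apply, hne d' hd', add_zero]
  have h2 : cosProd N k (c - e d) = cosMode (N d) (k d) (c d - 1)
      * ∏ d' ∈ Finset.univ.erase d, cosMode (N d') (k d') (c d') := by
    rw [cosProd, ← Finset.mul_prod_erase _ _ (Finset.mem_univ d), Pi.sub_apply, hs]
    congr 1
    exact Finset.prod_congr rfl fun d' hd' => by rw [Pi.sub_apply, hne d' hd', sub_zero]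
  have h3 : cosProd N k c = cosMode (N d) (k d) (c d)
      * ∏ d' ∈ Finset.univ.erase d, cosMode (N d') (k d') (c d') := by
    rw [cosProd, ← Finset.mul_prod_erase _ _ (Finset.mem_univ d)]
  rw [h1, h2, h3]
  have := cosMode_add_sub (N d) (k d) (c d)
  generalize ∏ d' ∈ Finset.univ.erase d, cosMode (N d') (k d') (c d') = P
  linear_combination (P / h ^ 2) * this

/-- The Neumann Laplacian is symmetric, so it acts on cosine coefficients as multiplication by
its eigenvalues. -/
lemma cosCoeff_div_grad {N : Fin 3 → ℕ} {h : ℝ} (hh : 0 < h) {f : Grid} (hf : Neumann N f)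
    (k : Fin 3 → ℕ) :
    cosCoeff N (div h (grad h f)) k = -eigen N h k * cosCoeff N f k := by
  have h1 := cellInner_div (hf.noFlux_grad h) h (cosProd N k)
  have h2 := cellInner_div ((neumann_cosProd N k).noFlux_grad h) h f
  rw [faceInner_comm, ← h1, cellInner, cellInner] at h2
  have h3 := mul_left_cancel₀ (by positivity) h2
  rw [cosCoeff, ← h3, cosCoeff, Finset.mul_sum]
  refine Finset.sum_congr rfl fun c _ => ?_
  rw [div_grad_cosProd]
  ring

lemma cosCoeff_zero (N : Fin 3 → ℕ) (f : Grid) : cosCoeff N f 0 = ∑ c ∈ cells N, f c := by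
  simp [cosCoeff, cosProd, cosMode]

lemma cosProd_sq_le_one (N k : Fin 3 → ℕ) (c : Fin 3 → ℤ) : cosProd N k c ^ 2 ≤ 1 := by
  rw [cosProd, ← Finset.prod_pow]
  exact Finset.prod_le_one (fun d _ => sq_nonneg _) fun d _ => Real.cos_sq_le_one _

lemma prodWeight_nonneg (N k : Fin 3 → ℕ) : 0 ≤ prodWeight N k :=
  Finset.prod_nonneg fun d _ => by unfold cosWeight; split_ifs <;> positivity

lemma prodWeight_le {N : Fin 3 → ℕ} {L : Pt} {h : ℝ} (hh : 0 < h) (hL : ∀ d, 0 < L d)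
    (hN : ∀ d, N d * h = L d) (k : Fin 3 → ℕ) : prodWeight N k ≤ 8 * h ^ 3 / ∏ d, L d := by
  have h1 : ∀ d, cosWeight (N d) (k d) ≤ 2 * h / L d := by
    intro d
    have hNd : (0 : ℝ) < N d := by
      have := hL d
      rw [← hN d] at this
      exact pos_of_mul_pos_left this hh.le
    rw [← hN d]
    unfold cosWeight
    split_ifs
    · rw [div_le_div_iff₀ hNd (by positivity)]
      nlinarith [mul_pos hNd hh]
    · rw [div_le_div_iff₀ hNd (by positivity)]
      nlinarith [mul_pos hNd hh]
  calc prodWeight N k ≤ ∏ d, (2 * h / L d) :=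
        Finset.prod_le_prod (fun d _ => by unfold cosWeight; split_ifs <;> positivity)
          fun d _ => h1 d
    _ = _ := by rw [Finset.prod_div_distrib]; simp; ring

lemma eigen_ge {N : Fin 3 → ℕ} {L : Pt} {h ℓ : ℝ} (hh : 0 < h) (hL : ∀ d, 0 < L d)
    (hℓ : ∀ d, L d ≤ ℓ) (hN : ∀ d, N d * h = L d) {k : Fin 3 → ℕ} (hk : k ∈ modes N) :
    4 / ℓ ^ 2 * ∑ d, (k d : ℝ) ^ 2 ≤ eigen N h k := by
  rw [eigen, Finset.mul_sum]
  refine Finset.sum_le_sum fun d _ => ?_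
  have hkd : k d < N d := by simpa [modes] using Fintype.mem_piFinset.1 hk d
  have hNd : (0 : ℝ) < N d := by exact_mod_cast (Nat.zero_le _).trans_lt hkd
  have hpi := Real.pi_pos
  have hle : (k d : ℝ) ≤ N d := by exact_mod_cast hkd.le
  have h1 := Real.cos_le_one_sub_mul_cos_sq (x := Real.pi * k d / N d) (by
    rw [abs_of_nonneg (by positivity), div_le_iff₀ hNd]
    gcongr)
  have h2 : 2 / Real.pi ^ 2 * (Real.pi * k d / N d) ^ 2 = 2 * (k d : ℝ) ^ 2 / (N d : ℝ) ^ 2 := by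
    field_simp
  rw [h2] at h1
  have hLd := hL d
  calc 4 / ℓ ^ 2 * (k d : ℝ) ^ 2 ≤ 4 / L d ^ 2 * (k d : ℝ) ^ 2 := by
        gcongr
        exact hℓ d
    _ = 2 * (2 * (k d : ℝ) ^ 2 / (N d : ℝ) ^ 2) / h ^ 2 := by
        rw [← hN d]; field_simp; ring
    _ ≤ _ := by gcongr; linarith

lemma summable_one_add_sq_rpow :
    Summable fun n : ℕ => (1 + (n : ℝ) ^ 2) ^ (-(2 / 3) : ℝ) := by
  refine ((Real.summable_nat_rpow (p := -(4 / 3))).2 (by norm_num)).of_norm_bounded_eventually_nat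
    ?_
  filter_upwards [Filter.eventually_gt_atTop 0] with n hn
  have hn' : (0 : ℝ) < n := by exact_mod_cast hn
  rw [Real.norm_of_nonneg (by positivity)]
  calc (1 + (n : ℝ) ^ 2) ^ (-(2 / 3) : ℝ) ≤ ((n : ℝ) ^ 2) ^ (-(2 / 3) : ℝ) :=
        Real.rpow_le_rpow_of_nonpos (by positivity) (by linarith) (by norm_num)
    _ = (n : ℝ) ^ (-(4 / 3) : ℝ) := by
        rw [← Real.rpow_natCast, ← Real.rpow_mul hn'.le]; norm_num

/-- In three dimensions `|k|⁻⁴` is summable away from the origin: it is dominated by a product of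
the one-dimensional summable sequence `(1 + n²)^(-2/3)`. -/
lemma inv_sq_sum_sq_le {k : Fin 3 → ℕ} (hk : k ≠ 0) :
    ((∑ d, (k d : ℝ) ^ 2) ^ 2)⁻¹ ≤ 4 * ∏ d, (1 + (k d : ℝ) ^ 2) ^ (-(2 / 3) : ℝ) := by
  set S : ℝ := ∑ d, (k d : ℝ) ^ 2 with hS
  have hS1 : 1 ≤ S := by
    obtain ⟨d, hd⟩ := Function.ne_iff.1 hk
    have h1 : (1 : ℝ) ≤ k d := by exact_mod_cast Nat.one_le_iff_ne_zero.2 hd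
    have : (k d : ℝ) ^ 2 ≤ S :=
      Finset.single_le_sum (f := fun d => (k d : ℝ) ^ 2) (fun _ _ => sq_nonneg _)
        (Finset.mem_univ d)
    nlinarith
  have h2 : ∀ d, (1 + S) ^ (-(2 / 3) : ℝ) ≤ (1 + (k d : ℝ) ^ 2) ^ (-(2 / 3) : ℝ) := by
    intro d
    refine Real.rpow_le_rpow_of_nonpos (by positivity) ?_ (by norm_num)
    have : (k d : ℝ) ^ 2 ≤ S :=
      Finset.single_le_sum (f := fun d => (k d : ℝ) ^ 2) (fun _ _ => sq_nonneg _)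
        (Finset.mem_univ d)
    linarith
  have h3 : ((1 + S) ^ 2)⁻¹ = ∏ _d : Fin 3, (1 + S) ^ (-(2 / 3) : ℝ) := by
    rw [Finset.prod_const, Finset.card_univ, Fintype.card_fin, ← Real.rpow_mul_natCast (by linarith),
      ← Real.rpow_natCast (1 + S) 2, ← Real.rpow_neg (by linarith)]
    norm_num
  calc (S ^ 2)⁻¹ ≤ 4 * ((1 + S) ^ 2)⁻¹ := by
        rw [← div_eq_mul_inv, inv_eq_one_div, div_le_div_iff₀ (by positivity) (by positivity)]
        nlinarith
    _ ≤ _ := by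
        rw [h3]
        refine mul_le_mul_of_nonneg_left ?_ (by norm_num)
        exact Finset.prod_le_prod (fun d _ => by positivity) fun d _ => h2 d

/-- The discrete Sobolev embedding of `H²` in `L^∞` for mean-free Neumann grid functions on a
fixed cuboid, with a constant that does not depend on the grid. -/
theorem exists_sq_le_cellInner_div_grad (L : Pt) (hL : ∀ d, 0 < L d) :
    ∃ C > 0, ∀ (N : Fin 3 → ℕ) (h : ℝ), 0 < h → (∀ d, N d * h = L d) → ∀ f : Grid,
      Neumann N f → ∑ c ∈ cells N, f c = 0 → ∀ c ∈ cells N,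
        f c ^ 2 ≤ C * cellInner N h (div h (grad h f)) (div h (grad h f)) := by
  set ℓ : ℝ := ∑ d, L d with hℓ
  have hLℓ : ∀ d, L d ≤ ℓ := fun d =>
    Finset.single_le_sum (fun d _ => (hL d).le) (Finset.mem_univ d)
  have hℓ0 : 0 < ℓ := (hL 0).trans_le (hLℓ 0)
  have hP : 0 < ∏ d, L d := Finset.prod_pos fun d _ => hL d
  set S : ℝ := ∑' n : ℕ, (1 + (n : ℝ) ^ 2) ^ (-(2 / 3) : ℝ) with hS
  have hS0 : 0 < S := by
    refine summable_one_add_sq_rpow.tsum_pos (fun n => by positivity) 0 (by positivity)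
  refine ⟨8 / (∏ d, L d) * ((ℓ ^ 2 / 4) ^ 2 * (4 * S ^ 3)), by positivity, ?_⟩
  intro N h hh hN f hf hmean c hc
  set g := div h (grad h f) with hg
  set w := prodWeight N
  -- the mode `0` does not contribute because `f` has mean zero
  have hrepr : f c = ∑ k ∈ (modes N).erase 0, w k * cosProd N k c * cosCoeff N f k := by
    rw [sum_cosCoeff hc f]
    refine (Finset.sum_erase _ ?_).symm
    rw [cosCoeff_zero, hmean, mul_zero]
  have heig : ∀ k ∈ (modes N).erase 0, 0 < 4 / ℓ ^ 2 * ∑ d, (k d : ℝ) ^ 2 := by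
    intro k hk
    obtain ⟨d, hd⟩ := Function.ne_iff.1 (Finset.ne_of_mem_erase hk)
    have : (0 : ℝ) < ∑ d, (k d : ℝ) ^ 2 :=
      Finset.sum_pos' (fun _ _ => sq_nonneg _)
        ⟨d, Finset.mem_univ d, by have : (k d : ℝ) ≠ 0 := by exact_mod_cast hd
                                  positivity⟩
    positivity
  have hle := fun k (hk : k ∈ (modes N).erase 0) =>
    eigen_ge hh hL hLℓ hN (Finset.mem_of_mem_erase hk)
  have hw := prodWeight_nonneg N
  have hcs : f c ^ 2 ≤ (∑ k ∈ (modes N).erase 0, w k / eigen N h k ^ 2)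
      * ∑ k ∈ (modes N).erase 0, w k * cosCoeff N g k ^ 2 := by
    rw [hrepr]
    calc (∑ k ∈ (modes N).erase 0, w k * cosProd N k c * cosCoeff N f k) ^ 2
        ≤ (∑ k ∈ (modes N).erase 0, w k * cosProd N k c ^ 2 / eigen N h k ^ 2)
          * ∑ k ∈ (modes N).erase 0, w k * cosCoeff N g k ^ 2 := by
          refine Finset.sum_sq_le_sum_mul_sum_of_sq_le_mul _ (fun k _ => ?_) (fun k _ => ?_)
            fun k hk => ?_
          · have := hw k; positivity
          · have := hw k; positivity
          · have : eigen N h k ≠ 0 := ((heig k hk).trans_le (hle k hk)).ne'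
            rw [hg, cosCoeff_div_grad hh hf]
            refine le_of_eq ?_
            field_simp
      _ ≤ _ := by
          have : 0 ≤ ∑ k ∈ (modes N).erase 0, w k * cosCoeff N g k ^ 2 :=
            Finset.sum_nonneg fun k _ => mul_nonneg (hw k) (sq_nonneg _)
          gcongr with k hk
          exact mul_le_of_le_one_right (hw k) (cosProd_sq_le_one N k c)
  have h2 : ∑ k ∈ (modes N).erase 0, w k * cosCoeff N g k ^ 2 ≤ ∑ c ∈ cells N, g c * g c := by
    rw [← sum_cosCoeff_sq]
    exact Finset.sum_le_sum_of_subset_of_nonneg (Finset.erase_subset _ _)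
      fun k _ _ => mul_nonneg (hw k) (sq_nonneg _)
  have h1 : ∑ k ∈ (modes N).erase 0, w k / eigen N h k ^ 2
      ≤ 8 * h ^ 3 / (∏ d, L d) * ((ℓ ^ 2 / 4) ^ 2 * (4 * S ^ 3)) := by
    calc ∑ k ∈ (modes N).erase 0, w k / eigen N h k ^ 2
        ≤ ∑ k ∈ (modes N).erase 0, 8 * h ^ 3 / (∏ d, L d) * ((ℓ ^ 2 / 4) ^ 2 *
            (4 * ∏ d, (1 + (k d : ℝ) ^ 2) ^ (-(2 / 3) : ℝ))) := by
          refine Finset.sum_le_sum fun k hk => ?_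
          rw [div_eq_mul_inv]
          refine mul_le_mul (prodWeight_le hh hL hN k) ?_ (by positivity) (by positivity)
          calc (eigen N h k ^ 2)⁻¹ ≤ ((4 / ℓ ^ 2 * ∑ d, (k d : ℝ) ^ 2) ^ 2)⁻¹ := by
                have := heig k hk
                have := hle k hk
                gcongr
            _ = (ℓ ^ 2 / 4) ^ 2 * ((∑ d, (k d : ℝ) ^ 2) ^ 2)⁻¹ := by
                rw [mul_pow, mul_inv, ← inv_pow, inv_div]
            _ ≤ _ := by
                gcongr
                exact inv_sq_sum_sq_le (Finset.ne_of_mem_erase hk)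
      _ = 8 * h ^ 3 / (∏ d, L d) * ((ℓ ^ 2 / 4) ^ 2 *
            (4 * ∑ k ∈ (modes N).erase 0, ∏ d, (1 + (k d : ℝ) ^ 2) ^ (-(2 / 3) : ℝ))) := by
          simp only [Finset.mul_sum]
      _ ≤ _ := by
          gcongr
          calc ∑ k ∈ (modes N).erase 0, ∏ d, (1 + (k d : ℝ) ^ 2) ^ (-(2 / 3) : ℝ)
              ≤ ∑ k ∈ modes N, ∏ d, (1 + (k d : ℝ) ^ 2) ^ (-(2 / 3) : ℝ) :=
                Finset.sum_le_sum_of_subset_of_nonneg (Finset.erase_subset _ _)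
                  fun k _ _ => by positivity
            _ = ∏ d, ∑ n ∈ Finset.range (N d), (1 + (n : ℝ) ^ 2) ^ (-(2 / 3) : ℝ) :=
                (Finset.prod_univ_sum (fun d => Finset.range (N d))
                  (fun _ n => (1 + (n : ℝ) ^ 2) ^ (-(2 / 3) : ℝ))).symm
            _ ≤ ∏ _d : Fin 3, S :=
                Finset.prod_le_prod (fun d _ => by positivity) fun d _ =>
                  summable_one_add_sq_rpow.sum_le_tsum _ fun n _ => by positivity
            _ = S ^ 3 := by simp
  calc f c ^ 2 ≤ _ := hcs
    _ ≤ (8 * h ^ 3 / (∏ d, L d) * ((ℓ ^ 2 / 4) ^ 2 * (4 * S ^ 3)))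
          * ∑ c ∈ cells N, g c * g c := by
        refine mul_le_mul h1 h2 ?_ (by positivity)
        exact Finset.sum_nonneg fun k _ => mul_nonneg (hw k) (sq_nonneg _)
    _ = _ := by rw [cellInner]; ring

/-! ### Consistency bounds for the exact solution -/

/-- The centre of the cell `c`. -/
def center (h : ℝ) (c : Fin 3 → ℤ) : Pt := fun d => ((c d : ℝ) - 1 / 2) * h

lemma center_mem_OmBar {N : Fin 3 → ℕ} {L : Pt} {h : ℝ} (hh : 0 < h) (hN : ∀ d, N d * h = L d)
    {c : Fin 3 → ℤ} (hc : c ∈ cells N) : center h c ∈ OmBar L := by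
  rw [mem_cells] at hc
  refine ⟨fun d => ?_, fun d => ?_⟩
  · have : (1 : ℝ) ≤ c d := by exact_mod_cast (hc d).1
    exact mul_nonneg (by linarith) hh.le
  · have : (c d : ℝ) ≤ N d := by exact_mod_cast (hc d).2
    rw [← hN d]
    exact mul_le_mul_of_nonneg_right (by linarith) hh.le

lemma gridProj_of_mem {N : Fin 3 → ℕ} {c : Fin 3 → ℤ} (hc : c ∈ cells N) (h : ℝ) (v : Pt → ℝ) :
    gridProj N h v c = v (center h c) := ghostFill_of_mem hc _

lemma center_add_e (h : ℝ) (c : Fin 3 → ℤ) (d : Fin 3) :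
    center h (c + e d) = center h c + h • Pi.single d 1 := by
  ext d'
  by_cases hd : d' = d
  · subst hd; simp [center, e]; ring
  · simp [center, e, hd]

lemma center_sub_e (h : ℝ) (c : Fin 3 → ℤ) (d : Fin 3) :
    center h (c - e d) = center h c - h • Pi.single d 1 := by
  ext d'
  by_cases hd : d' = d
  · subst hd; simp [center, e]; ring
  · simp [center, e, hd]

/-- First-order Taylor estimate on the closed cuboid. -/
lemma abs_sub_sub_fderivWithin_le {L : Pt} (hL : ∀ d, 0 < L d) {f : Pt → ℝ} {K : ℝ}
    (hf : ContDiffOn ℝ 2 f (OmBar L))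
    (hK : ∀ x ∈ OmBar L, ‖iteratedFDerivWithin ℝ 2 f (OmBar L) x‖ ≤ K)
    {x : Pt} (hx : x ∈ OmBar L) {d : Fin 3} {r : ℝ} (hy : x + r • Pi.single d 1 ∈ OmBar L) :
    |f (x + r • Pi.single d 1) - f x - r * fderivWithin ℝ f (OmBar L) x (Pi.single d 1)|
      ≤ K * r ^ 2 := by
  have hconv : Convex ℝ (OmBar L) := convex_Icc _ _
  have hint : (interior (OmBar L)).Nonempty := by
    rw [OmBar, ← Set.pi_univ_Icc, interior_pi_set finite_univ]
    refine Set.univ_pi_nonempty_iff.2 fun d => ?_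
    rw [interior_Icc]
    exact nonempty_Ioo.2 (hL d)
  have huniq : UniqueDiffOn ℝ (OmBar L) := uniqueDiffOn_convex hconv hint
  have hdf : DifferentiableOn ℝ f (OmBar L) := hf.differentiableOn (by norm_num)
  have hddf : DifferentiableOn ℝ (fderivWithin ℝ f (OmBar L)) (OmBar L) :=
    (hf.fderivWithin huniq (m := 1) (by norm_num)).differentiableOn (by norm_num)
  have hlip : ∀ y ∈ OmBar L, ‖fderivWithin ℝ f (OmBar L) y - fderivWithin ℝ f (OmBar L) x‖
      ≤ K * ‖y - x‖ := by
    intro y hy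
    refine hconv.norm_image_sub_le_of_norm_fderivWithin_le hddf (fun z hz => ?_) hx hy
    rw [← norm_iteratedFDerivWithin_one _ (huniq z hz),
      norm_iteratedFDerivWithin_fderivWithin huniq hz]
    exact hK z hz
  have hK0 : 0 ≤ K := (norm_nonneg _).trans (hK x hx)
  set y := x + r • (Pi.single d 1 : Pt) with hydef
  have hyx : ‖y - x‖ = |r| := by
    rw [hydef, add_sub_cancel_left, norm_smul, Pi.norm_single]; simp
  have hseg : segment ℝ x y ⊆ OmBar L := hconv.segment_subset hx hy
  have := (convex_segment (𝕜 := ℝ) x y).norm_image_sub_le_of_norm_hasFDerivWithin_le'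
    (f := f) (f' := fderivWithin ℝ f (OmBar L)) (φ := fderivWithin ℝ f (OmBar L) x)
    (C := K * |r|) (fun z hz => (hdf z (hseg hz)).hasFDerivWithinAt.mono hseg)
    (fun z hz => by
      refine (hlip z (hseg hz)).trans ?_
      rw [← hyx]
      gcongr
      exact norm_sub_le_of_mem_segment hz)
    (left_mem_segment ℝ x y) (right_mem_segment ℝ x y)
  rw [hyx, mul_assoc, ← sq, sq_abs, Real.norm_eq_abs] at this
  convert this using 3
  rw [hydef, add_sub_cancel_left, map_smul, smul_eq_mul]

/-- The discrete Laplacian of the grid projection of a `C²` function with vanishing normal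
derivative is bounded up to the boundary. In a boundary cell the ghost value leaves a first
difference; it is of second order because the derivative vanishes on the face. -/
lemma abs_div_grad_gridProj_le {N : Fin 3 → ℕ} {L : Pt} (hL : ∀ d, 0 < L d) {h : ℝ} (hh : 0 < h)
    (hN : ∀ d, N d * h = L d) {f : Pt → ℝ} {K : ℝ} (hf : ContDiffOn ℝ 2 f (OmBar L))
    (hK : ∀ x ∈ OmBar L, ‖iteratedFDerivWithin ℝ 2 f (OmBar L) x‖ ≤ K)
    (hbc : NormalDerivZero L f) {c : Fin 3 → ℤ} (hc : c ∈ cells N) :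
    |div h (grad h (gridProj N h f)) c| ≤ 9 * K := by
  have hx := center_mem_OmBar hh hN hc
  have hK0 : 0 ≤ K := (norm_nonneg _).trans (hK _ hx)
  have key : ∀ d, |gridProj N h f (c + e d) - 2 * gridProj N h f c + gridProj N h f (c - e d)|
      ≤ 3 * K * h ^ 2 := by
    intro d
    have hneu := neumann_ghostFill N (fun c => f (center h c)) c hc d
    change (c d = 1 → gridProj N h f (c - e d) = gridProj N h f c) ∧
      (c d = N d → gridProj N h f (c + e d) = gridProj N h f c) at hneu
    have hnn : 0 ≤ K * h ^ 2 := by positivity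
    -- the foot of the perpendicular from the centre of the cell to a boundary face
    have foot : ∀ σ : ℝ, (center h c d + σ * (h / 2) = 0 ∨ center h c d + σ * (h / 2) = L d) →
        center h c + (σ * (h / 2)) • Pi.single d 1 ∈ OmBar L := by
      intro σ hσ
      refine ⟨fun d' => ?_, fun d' => ?_⟩ <;> by_cases hd : d' = d
      · subst hd
        rcases hσ with hσ | hσ <;> simp [hσ, (hL d').le]
      · simpa [hd] using hx.1 d'
      · subst hd
        rcases hσ with hσ | hσ <;> simp [hσ, (hL d').le]
      · simpa [hd] using hx.2 d'
    -- near a boundary face, a first difference along the normal is of second order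
    have bdry : ∀ σ : ℝ, σ ^ 2 = 1 →
        (center h c d + σ * (h / 2) = 0 ∨ center h c d + σ * (h / 2) = L d) →
        center h c - (σ * h) • Pi.single d 1 ∈ OmBar L →
        |f (center h c - (σ * h) • Pi.single d 1) - f (center h c)| ≤ 3 * K * h ^ 2 := by
      intro σ hσ2 hσ hy
      have hz := foot σ hσ
      set z := center h c + (σ * (h / 2)) • (Pi.single d 1 : Pt) with hzdef
      have hDz : fderivWithin ℝ f (OmBar L) z (Pi.single d 1) = 0 := by
        refine hbc z hz d ?_
        simpa [hzdef] using hσ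
      have e1 : center h c = z + (-(σ * (h / 2))) • (Pi.single d 1 : Pt) := by
        rw [hzdef]; module
      have e2 : center h c - (σ * h) • (Pi.single d 1 : Pt)
          = z + (-(σ * (3 * h / 2))) • (Pi.single d 1 : Pt) := by
        rw [hzdef]; module
      have t1 := abs_sub_sub_fderivWithin_le hL hf hK hz (by rw [← e1]; exact hx)
      have t2 := abs_sub_sub_fderivWithin_le hL hf hK hz (by rw [← e2]; exact hy)
      rw [← e1, hDz, mul_zero, sub_zero, neg_sq, mul_pow, hσ2] at t1
      rw [← e2, hDz, mul_zero, sub_zero, neg_sq, mul_pow, hσ2] at t2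
      rw [abs_le] at t1 t2 ⊢
      constructor <;> nlinarith
    by_cases h1 : c d = 1 <;> by_cases h2 : c d = N d
    · rw [hneu.1 h1, hneu.2 h2]
      ring_nf
      rw [abs_zero]
      positivity
    · have hp := add_e_mem_cells hc h2
      have hcd : center h c d = h / 2 := by simp [center, h1]; ring
      have := bdry (-1) (by norm_num) (Or.inl (by rw [hcd]; ring)) (by
        rw [neg_one_mul, neg_smul, sub_neg_eq_add, ← center_add_e]
        exact center_mem_OmBar hh hN hp)
      rw [neg_one_mul, neg_smul, sub_neg_eq_add, ← center_add_e] at this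
      rw [hneu.1 h1, gridProj_of_mem hp, gridProj_of_mem hc]
      convert this using 2
      ring
    · have hm := sub_e_mem_cells hc h1
      have hcd : center h c d = L d - h / 2 := by
        rw [← hN d]; simp [center, h2]; ring
      have := bdry 1 (by norm_num) (Or.inr (by rw [hcd]; ring)) (by
        rw [one_mul, ← center_sub_e]
        exact center_mem_OmBar hh hN hm)
      rw [one_mul, ← center_sub_e] at this
      rw [hneu.2 h2, gridProj_of_mem hm, gridProj_of_mem hc]
      convert this using 2
      ring
    · have hp := add_e_mem_cells hc h2
      have hm := sub_e_mem_cells hc h1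
      rw [gridProj_of_mem hp, gridProj_of_mem hm, gridProj_of_mem hc]
      have e2 : center h (c - e d) = center h c + (-h) • (Pi.single d 1 : Pt) := by
        rw [center_sub_e]; module
      have t1 := abs_sub_sub_fderivWithin_le hL hf hK hx (d := d) (r := h)
        (by rw [← center_add_e]; exact center_mem_OmBar hh hN hp)
      have t2 := abs_sub_sub_fderivWithin_le hL hf hK hx (d := d) (r := -h)
        (by rw [← e2]; exact center_mem_OmBar hh hN hm)
      rw [← center_add_e] at t1
      rw [← e2] at t2
      rw [abs_le] at t1 t2 ⊢
      constructor <;> nlinarith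
  rw [div_grad_apply]
  calc |∑ d, (gridProj N h f (c + e d) - 2 * gridProj N h f c + gridProj N h f (c - e d)) / h ^ 2|
      ≤ ∑ d, |(gridProj N h f (c + e d) - 2 * gridProj N h f c
          + gridProj N h f (c - e d)) / h ^ 2| := Finset.abs_sum_le_sum_abs _ _
    _ ≤ ∑ _d : Fin 3, 3 * K := by
        refine Finset.sum_le_sum fun d _ => ?_
        rw [abs_div, abs_of_pos (by positivity : 0 < h ^ 2), div_le_iff₀ (by positivity)]
        exact key d
    _ = 9 * K := by simp; ring

/-- A continuous function on `[0,T]` that is bounded by `K` at almost every time is bounded by `K`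
at every time. -/
lemma abs_le_of_ae_Icc {T K : ℝ} (hT : 0 < T) {g : ℝ → ℝ} (hg : ContinuousOn g (Icc 0 T))
    (h : ∀ᵐ t ∂(volume.restrict (Ioo 0 T)), |g t| ≤ K) : ∀ t ∈ Icc 0 T, |g t| ≤ K := by
  have h' : ∀ᵐ t : ℝ, t ∈ Ioo 0 T → |g t| ≤ K := (ae_restrict_iff' measurableSet_Ioo).1 h
  have hd : Dense {t : ℝ | t ∈ Ioo 0 T → |g t| ≤ K} := Measure.dense_of_ae h'
  have hcl : Icc 0 T ⊆ closure (Ioo 0 T ∩ {t : ℝ | t ∈ Ioo 0 T → |g t| ≤ K}) := by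
    rw [← closure_Ioo hT.ne]
    exact closure_minimal (hd.open_subset_closure_inter isOpen_Ioo) isClosed_closure
  have hclosed : IsClosed (Icc 0 T ∩ (fun t => |g t|) ⁻¹' Iic K) :=
    hg.abs.preimage_isClosed_of_isClosed isClosed_Icc isClosed_Iic
  intro t ht
  refine (closure_minimal ?_ hclosed (hcl ht)).2
  rintro τ ⟨hτ, hτ'⟩
  exact ⟨Ioo_subset_Icc_self hτ, hτ' hτ⟩

lemma continuousOn_gridProj {N : Fin 3 → ℕ} {L : Pt} {T h : ℝ} {φ : ℝ → Pt → ℝ}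
    (hφ : ContinuousOn (fun q : ℝ × Pt => φ q.1 q.2) (Icc 0 T ×ˢ OmBar L)) (hh : 0 < h)
    (hL : ∀ d, 0 < L d) (hN : ∀ d, N d * h = L d) (c : Fin 3 → ℤ) :
    ContinuousOn (fun t => gridProj N h (φ t) c) (Icc 0 T) := by
  have hmem : (fun d => max 1 (min (c d) (N d))) ∈ cells N := by
    rw [mem_cells]
    intro d
    have : N d ≠ 0 := by
      rintro h0
      have := hL d
      rw [← hN d, h0] at this
      simp at this
    omega
  have : ∀ t, gridProj N h (φ t) c = φ t (center h fun d => max 1 (min (c d) (N d))) :=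
    fun t => rfl
  simp only [this]
  refine hφ.comp (f := fun t => (t, center h fun d => max 1 (min (c d) (N d))))
    (by fun_prop) fun t ht => ⟨ht, center_mem_OmBar hh hN hmem⟩

/-- The grid projections of the exact solution and their discrete Laplacians are bounded,
uniformly in time and in the grid. -/
theorem exists_bound_gridProj {L : Pt} (hL : ∀ d, 0 < L d) {T : ℝ} (hT : 0 < T)
    {φ : ℝ → Pt → ℝ} (hreg : RegularityClass L T φ)
    (hbc : ∀ t ∈ Ioc 0 T, NormalDerivZero L (φ t)) :
    ∃ K > 0, ∀ (N : Fin 3 → ℕ) (h : ℝ), 0 < h → (∀ d, N d * h = L d) →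
      ∀ t ∈ Icc 0 T, ∀ c ∈ cells N, |gridProj N h (φ t) c| ≤ K ∧
        |div h (grad h (gridProj N h (φ t))) c| ≤ K := by
  obtain ⟨K₀, hK₀⟩ := (isCompact_Icc.prod isCompact_Icc).exists_bound_of_continuousOn hreg.cont
  obtain ⟨hsm, hJ⟩ := hreg.linftyc6
  obtain ⟨J, hJ1, hJ2⟩ := hJ 2 (by norm_num)
  set K₁ : ℝ := (eLpNorm J ⊤ (volume.restrict (Ioo 0 T))).toReal with hK₁
  have hae : ∀ᵐ t ∂(volume.restrict (Ioo 0 T)), ‖J t‖ ≤ K₁ := by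
    have hfin := hJ2.eLpNorm_lt_top
    have := ae_le_eLpNormEssSup (f := J) (μ := volume.restrict (Ioo 0 T))
    filter_upwards [this] with t ht
    rw [← eLpNorm_exponent_top] at ht
    have := ENNReal.toReal_mono hfin.ne ht
    simpa [hK₁] using this
  refine ⟨|K₀| + 9 * |K₁| + 1, by positivity, fun N h hh hN t ht c hc => ⟨?_, ?_⟩⟩
  · rw [gridProj_of_mem hc]
    have := hK₀ (t, center h c) ⟨ht, center_mem_OmBar hh hN hc⟩
    rw [Real.norm_eq_abs] at this
    linarith [le_abs_self K₀, abs_nonneg K₁]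
  · refine (abs_le_of_ae_Icc hT (K := 9 * K₁)
      (g := fun t => div h (grad h (gridProj N h (φ t))) c) ?_ ?_ t ht).trans ?_
    · simp only [div_grad_apply]
      have := fun c' => continuousOn_gridProj (N := N) hreg.cont hh hL hN c'
      refine continuousOn_finsetSum _ fun d _ => ContinuousOn.div_const ?_ _
      exact ((this _).sub (continuousOn_const.mul (this _))).add (this _)
    · filter_upwards [hsm, hJ1, hae, ae_restrict_mem measurableSet_Ioo] with t h1 h2 h3 h4
      refine abs_div_grad_gridProj_le hL hh hN (h1.of_le (by norm_num)) (fun x hx => ?_)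
        (hbc t ⟨h4.1, h4.2.le⟩) hc
      have := h2 ⟨x, hx⟩
      rw [← this]
      exact ((J t).norm_coe_le_norm _).trans h3
    · linarith [le_abs_self K₁, abs_nonneg K₀]

/-! ### The sup norm bound for one time step -/

/-- Minus the discrete velocity, `γ A ∇_h μ + ∇_h p`. -/
def darcyFlux (γ h : ℝ) (A : Face) (μ p : Grid) : Face := γ • (A * grad h μ) + grad h p

/-- The mass flux `∇_h μ + A (γ A ∇_h μ + ∇_h p)`. -/
def massFlux (γ h : ℝ) (A : Face) (μ p : Grid) : Face :=
  grad h μ + A * darcyFlux γ h A μ p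

section Flux

variable {N : Fin 3 → ℕ} {h γ : ℝ} {A : Face} {μ p : Grid}

lemma noFlux_massFlux (hμ : Neumann N μ) (hp : Neumann N p) :
    NoFlux N (massFlux γ h A μ p) :=
  (hμ.noFlux_grad h).add
    (((((hμ.noFlux_grad h).mul A).smul γ).add (hp.noFlux_grad h)).mul A)

/-- The discrete velocity is divergence-free, hence orthogonal to the pressure gradient. -/
lemma faceInner_grad_darcyFlux (hμ : Neumann N μ) (hp : Neumann N p)
    (hpr : ∀ c ∈ cells N, div h (grad h p) c = -γ * div h (A * grad h μ) c) :
    faceInner N h (grad h p) (darcyFlux γ h A μ p) = 0 := by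
  have h1 := cellInner_div (hp.noFlux_grad h) h p
  have h2 := cellInner_div ((hμ.noFlux_grad h).mul A) h p
  have h3 : cellInner N h p (div h (grad h p))
      = cellInner N h p ((-γ) • div h (A * grad h μ)) :=
    cellInner_congr (fun _ _ => rfl) hpr
  rw [cellInner_smul_right] at h3
  rw [darcyFlux, faceInner_add_right, faceInner_smul_right]
  linear_combination h1 + γ * h2 - h3

lemma darcyFlux_self (hμ : Neumann N μ) (hp : Neumann N p)
    (hpr : ∀ c ∈ cells N, div h (grad h p) c = -γ * div h (A * grad h μ) c) :
    faceInner N h (darcyFlux γ h A μ p) (darcyFlux γ h A μ p)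
      = γ * faceInner N h (A * grad h μ) (darcyFlux γ h A μ p) := by
  have h1 := faceInner_grad_darcyFlux hμ hp hpr
  set Q := darcyFlux γ h A μ p with hQ
  nth_rewrite 2 [hQ]
  rw [darcyFlux, faceInner_add_right, faceInner_smul_right, faceInner_comm N h Q (grad h p), h1,
    faceInner_comm N h Q]
  ring

lemma gradNormSq_le_massFlux (hh : 0 ≤ h) (hγ : 0 < γ) (hμ : Neumann N μ) (hp : Neumann N p)
    (hpr : ∀ c ∈ cells N, div h (grad h p) c = -γ * div h (A * grad h μ) c) :
    gradNormSq N h μ ≤ faceInner N h (grad h μ) (massFlux γ h A μ p) := by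
  have h1 := darcyFlux_self hμ hp hpr
  have h2 := faceInner_self_nonneg N hh (darcyFlux γ h A μ p)
  rw [h1] at h2
  have h3 := nonneg_of_mul_nonneg_right h2 hγ
  rw [massFlux, faceInner_add_right, ← faceInner_mul_left, gradNormSq]
  linarith

lemma massFlux_self_le {K : ℝ} (hh : 0 ≤ h) (hμ : Neumann N μ) (hp : Neumann N p)
    (hA : ∀ c ∈ cells N, ∀ d, |A d c| ≤ K ∧ |A d (c - e d)| ≤ K)
    (hpr : ∀ c ∈ cells N, div h (grad h p) c = -γ * div h (A * grad h μ) c) :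
    faceInner N h (massFlux γ h A μ p) (massFlux γ h A μ p)
      ≤ 2 * (1 + γ ^ 2 * K ^ 4) * gradNormSq N h μ := by
  have h1 := darcyFlux_self hμ hp hpr
  have h2 := faceInner_sq_le N hh (A * grad h μ) (darcyFlux γ h A μ p)
  have h3 := faceInner_mul_self_le hh hA (grad h μ)
  have h4 := faceInner_mul_self_le hh hA (darcyFlux γ h A μ p)
  have h5 := faceInner_add_self_le N hh (grad h μ) (A * darcyFlux γ h A μ p)
  have h6 := faceInner_self_nonneg N hh (darcyFlux γ h A μ p)
  have h8 := faceInner_self_nonneg N hh (grad h μ)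
  rw [massFlux]
  set Q := faceInner N h (darcyFlux γ h A μ p) (darcyFlux γ h A μ p)
  set X := faceInner N h (grad h μ) (grad h μ) with hX
  set AX := faceInner N h (A * grad h μ) (A * grad h μ)
  have h7 : Q ≤ γ ^ 2 * AX := by
    rcases h6.eq_or_lt with h0 | h0
    · rw [← h0]
      have := faceInner_self_nonneg N hh (A * grad h μ)
      positivity
    · refine le_of_mul_le_mul_right ?_ h0
      calc Q * Q = γ ^ 2 * faceInner N h (A * grad h μ) (darcyFlux γ h A μ p) ^ 2 := by
            rw [h1]; ring
        _ ≤ γ ^ 2 * (AX * Q) := by gcongr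
        _ = _ := by ring
  have h9 : Q ≤ γ ^ 2 * (K ^ 2 * X) := h7.trans (by gcongr)
  have h10 : K ^ 2 * Q ≤ K ^ 2 * (γ ^ 2 * (K ^ 2 * X)) := by gcongr
  rw [gradNormSq, ← hX]
  linarith

end Flux

/-- The scalar inequalities behind the estimate of one time step. Here `X = ‖∇μ‖²`,
`Y = ‖∇w‖²`, `W = ‖w‖²`, `V = ‖w‖₄⁴`, `Z = ‖Δw‖²`, and `a = ε²`. -/
lemma laplacian_bound_of_energy {a κ Γ K C s X Y W V Z R P D U q : ℝ} (ha : 0 < a) (hκ : 0 < κ)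
    (hC : 0 < C) (hs : 0 < s) (hX : 0 ≤ X) (hY : 0 ≤ Y) (hW : 0 ≤ W) (hV : 0 ≤ V)
    (hZ : 0 ≤ Z) (hq0 : 0 ≤ q) (hΓ : 0 ≤ Γ)
    (hen : s * X + 3 / 4 * a * Y + V / 12 ≤ R) (hR : R ^ 2 ≤ W * Γ)
    (hWXY : W ^ 2 ≤ s ^ 2 * κ * (X * Y))
    (hlap : 3 / 4 * a * Z = P - D + U) (hP : P ^ 2 ≤ Z * q) (hD : D ^ 2 ≤ Z * Γ)
    (hU : U ^ 2 ≤ X * Y) (hq : q ≤ 2 * (C * Z) * V + 8 * K ^ 4 * W)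
    (hsmall : s * (4 * κ / (3 * a) * Γ ^ 2) ≤ (a ^ 2 / (192 * C)) ^ 2) :
    Z ≤ 4 / a * (2 / a * (8 * K ^ 4 * (s * (4 * κ / (3 * a)) * Γ) + Γ)
      + 1 + 4 * κ / (3 * a) * Γ ^ 2 * (4 / (3 * a))) := by
  set κ' := 4 * κ / (3 * a) with hκ'
  have hκ'0 : 0 < κ' := by positivity
  have hsX : s * X ≤ R := by linarith [mul_nonneg ha.le hY]
  have haY : 3 / 4 * a * Y ≤ R := by linarith [mul_nonneg hs.le hX]
  have haY0 : 0 ≤ 3 / 4 * a * Y := by positivity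
  have hR0 : 0 ≤ R := le_trans (by positivity) haY
  have hXY : s * X * (3 / 4 * a * Y) ≤ R ^ 2 := by
    rw [sq]; exact mul_le_mul hsX haY haY0 hR0
  have hWs : W ^ 2 ≤ s * κ' * (W * Γ) := by
    calc W ^ 2 ≤ s ^ 2 * κ * (X * Y) := hWXY
      _ = s * κ' * (s * X * (3 / 4 * a * Y)) := by rw [hκ']; field_simp
      _ ≤ s * κ' * (W * Γ) := by
          have := hXY.trans hR
          gcongr
  have hWle : W ≤ s * κ' * Γ := by
    rcases hW.eq_or_lt with h0 | h0
    · rw [← h0]; positivity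
    · refine le_of_mul_le_mul_right ?_ h0
      linarith
  have hR2 : R ^ 2 ≤ s * (κ' * Γ ^ 2) := by
    calc R ^ 2 ≤ W * Γ := hR
      _ ≤ s * κ' * Γ * Γ := by gcongr
      _ = _ := by ring
  have hRle : R ≤ a ^ 2 / (192 * C) :=
    (sq_le_sq₀ hR0 (by positivity)).1 (hR2.trans hsmall)
  have hXYle : X * Y ≤ κ' * Γ ^ 2 * (4 / (3 * a)) := by
    refine le_of_mul_le_mul_left ?_ (by positivity : 0 < s * (3 / 4 * a))
    calc s * (3 / 4 * a) * (X * Y) = s * X * (3 / 4 * a * Y) := by ring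
      _ ≤ s * (κ' * Γ ^ 2) := hXY.trans hR2
      _ = _ := by field_simp
  have hUle : U ≤ 1 + κ' * Γ ^ 2 * (4 / (3 * a)) := by nlinarith [sq_nonneg (U - 1)]
  -- Young's inequality, with a weight that lets the left-hand side absorb the terms in `Z`
  have young : ∀ x b : ℝ, 0 ≤ b → x ^ 2 ≤ Z * b → |x| ≤ a / 8 * Z + 2 / a * b := by
    intro x b hb hx
    refine abs_le_of_sq_le_sq (hx.trans ?_) (by positivity)
    have : a / 8 * Z * (2 / a * b) = Z * b / 4 := by field_simp; ring
    nlinarith [sq_nonneg (a / 8 * Z - 2 / a * b)]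
  have hP' := (abs_le.1 (young P q hq0 hP)).2
  have hD' := (abs_le.1 (young D Γ hΓ hD)).1
  have hVle : 2 / a * (2 * (C * Z) * V) ≤ a / 4 * Z := by
    have h12 : V ≤ 12 * (a ^ 2 / (192 * C)) := by linarith [mul_nonneg hs.le hX]
    calc 2 / a * (2 * (C * Z) * V) ≤ 2 / a * (2 * (C * Z) * (12 * (a ^ 2 / (192 * C)))) := by
          gcongr
      _ = a / 4 * Z := by field_simp; ring
  have hq' : 2 / a * q ≤ a / 4 * Z + 2 / a * (8 * K ^ 4 * (s * κ' * Γ)) := by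
    calc 2 / a * q ≤ 2 / a * (2 * (C * Z) * V + 8 * K ^ 4 * (s * κ' * Γ)) := by
          gcongr
          exact hq.trans (by gcongr)
      _ = 2 / a * (2 * (C * Z) * V) + 2 / a * (8 * K ^ 4 * (s * κ' * Γ)) := by ring
      _ ≤ _ := by gcongr
  have hfin : a / 4 * Z ≤ 2 / a * (8 * K ^ 4 * (s * κ' * Γ) + Γ)
      + 1 + κ' * Γ ^ 2 * (4 / (3 * a)) := by
    linarith
  calc Z = 4 / a * (a / 4 * Z) := by field_simp
    _ ≤ _ := by gcongr

lemma cubic_increment_sq_le {w f K S : ℝ} (hf : |f| ≤ K) (hw : w ^ 2 ≤ S) :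
    (w * (w ^ 2 + 4 * f * w + 6 * f ^ 2) / 4) ^ 2 ≤ 2 * S * w ^ 4 + 8 * K ^ 4 * w ^ 2 := by
  have hf2 : f ^ 2 ≤ K ^ 2 := by rw [← sq_abs]; gcongr
  have h0 : 0 ≤ w ^ 2 + 4 * f * w + 6 * f ^ 2 := by nlinarith [sq_nonneg (w + 2 * f)]
  have h1 : w ^ 2 + 4 * f * w + 6 * f ^ 2 ≤ 3 * w ^ 2 + 8 * K ^ 2 := by
    nlinarith [sq_nonneg (w - f)]
  have h2 : (w ^ 2 + 4 * f * w + 6 * f ^ 2) ^ 2 ≤ (3 * w ^ 2 + 8 * K ^ 2) ^ 2 := by gcongr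
  have h3 : (3 * w ^ 2 + 8 * K ^ 2) ^ 2 ≤ 18 * w ^ 4 + 128 * K ^ 4 := by
    nlinarith [sq_nonneg (3 * w ^ 2 - 8 * K ^ 2)]
  have h4 : w ^ 2 * (w ^ 2 + 4 * f * w + 6 * f ^ 2) ^ 2 ≤ w ^ 2 * (18 * w ^ 4 + 128 * K ^ 4) :=
    mul_le_mul_of_nonneg_left (h2.trans h3) (sq_nonneg w)
  have h5 : w ^ 4 * w ^ 2 ≤ w ^ 4 * S := by gcongr
  have h6 : 0 ≤ w ^ 4 * w ^ 2 := by positivity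
  nlinarith

/-- The increment `w` of one time step is bounded in the sup norm. Here `φ` is the old value,
`A` the velocity coefficient, and the chemical potential is written as the increment of the cubic
term, minus data `G` that depend on old values only, minus `(3/4) ε² Δ_h w`. The energy identity
controls `‖w‖²` by `s`; testing the equation for `μ` with `Δ_h w` then bounds `‖Δ_h w‖`, where the
cubic term is absorbed for small `s` by the embedding of `H²` in `L^∞`. -/
theorem exists_increment_bound (L : Pt) (hL : ∀ d, 0 < L d) {ε γ K Γ : ℝ} (hε : 0 < ε)
    (hγ : 0 < γ) (hK : 0 < K) (hΓ : 0 < Γ) :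
    ∃ s₁ > 0, ∃ B, ∀ (N : Fin 3 → ℕ) (h s : ℝ), 0 < h → (∀ d, N d * h = L d) → 0 < s → s ≤ s₁ →
      ∀ (A : Face) (w μ p φ G : Grid),
        (∀ c ∈ cells N, ∀ d, |A d c| ≤ K ∧ |A d (c - e d)| ≤ K) →
        (∀ c ∈ cells N, |φ c| ≤ K) → cellInner N h G G ≤ Γ →
        Neumann N w → Neumann N μ → Neumann N p →
        (∀ c ∈ cells N, w c = s * div h (massFlux γ h A μ p) c) →
        (∀ c ∈ cells N, μ c = w c * (w c ^ 2 + 4 * φ c * w c + 6 * φ c ^ 2) / 4 - G c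
          - 3 / 4 * ε ^ 2 * div h (grad h w) c) →
        (∀ c ∈ cells N, div h (grad h p) c = -γ * div h (A * grad h μ) c) →
        ∀ c ∈ cells N, |w c| ≤ B := by
  obtain ⟨C, hC, hemb⟩ := exists_sq_le_cellInner_div_grad L hL
  set κ : ℝ := 2 * (1 + γ ^ 2 * K ^ 4) with hκ
  have hκ0 : 0 < κ := by positivity
  set κ' : ℝ := 4 * κ / (3 * ε ^ 2) with hκ'
  have hκ'0 : 0 < κ' := by positivity
  set σ : ℝ := ((ε ^ 2) ^ 2 / (192 * C)) ^ 2 / (κ' * Γ ^ 2) with hσ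
  have hσ0 : 0 < σ := by positivity
  set B₁ : ℝ := 4 / ε ^ 2 * (2 / ε ^ 2 * (8 * K ^ 4 * (1 * κ' * Γ) + Γ)
      + 1 + κ' * Γ ^ 2 * (4 / (3 * ε ^ 2))) with hB₁
  refine ⟨min 1 σ, lt_min one_pos hσ0, √(C * B₁), ?_⟩
  intro N h s hh hN hs hs₁ A w μ p φ G hA hφ hG hwN hμN hpN hstep hchem hpr c hc
  set F := massFlux γ h A μ p with hF
  have hFN : NoFlux N F := noFlux_massFlux hμN hpN
  -- testing the mass equation with an arbitrary grid function
  have htest : ∀ f, cellInner N h f w = -s * faceInner N h (grad h f) F := by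
    intro f
    have h1 : cellInner N h f w = cellInner N h f (s • div h F) :=
      cellInner_congr (fun _ _ => rfl) hstep
    rw [h1, cellInner_smul_right, cellInner_div hFN]
    ring
  have hmean : ∑ c ∈ cells N, w c = 0 := by
    rw [Finset.sum_congr rfl hstep, ← Finset.mul_sum, sum_div_eq_zero hFN hh.ne', mul_zero]
  set Z := cellInner N h (div h (grad h w)) (div h (grad h w)) with hZ
  have hsup : ∀ c ∈ cells N, w c ^ 2 ≤ C * Z := hemb N h hh hN w hwN hmean
  set q : Grid := fun c => w c * (w c ^ 2 + 4 * φ c * w c + 6 * φ c ^ 2) / 4 with hq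
  set V := cellInner N h (w * w) (w * w) with hV
  have hμ : ∀ f, cellInner N h f μ = cellInner N h f q - cellInner N h f G
      - 3 / 4 * ε ^ 2 * cellInner N h f (div h (grad h w)) := by
    intro f
    have h1 : cellInner N h f μ
        = cellInner N h f (q - G - (3 / 4 * ε ^ 2) • div h (grad h w)) :=
      cellInner_congr (fun _ _ => rfl) hchem
    rw [h1, cellInner_sub_right, cellInner_sub_right, cellInner_smul_right]
  have hww := cellInner_div (hwN.noFlux_grad h) h w
  have hμw := cellInner_div (hwN.noFlux_grad h) h μ
  have hgF := gradNormSq_le_massFlux hh.le hγ hμN hpN hpr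
  have hFF := massFlux_self_le hh.le hμN hpN hA hpr
  rw [← hF, ← hκ] at hFF
  rw [← hF] at hgF
  have hX0 : 0 ≤ gradNormSq N h μ := faceInner_self_nonneg N hh.le _
  have hY0 : 0 ≤ gradNormSq N h w := faceInner_self_nonneg N hh.le _
  have hwq : V / 12 ≤ cellInner N h w q := by
    have h1 : V / 12 = cellInner N h (w * w) ((1 / 12 : ℝ) • (w * w)) := by
      rw [cellInner_smul_right]; ring
    rw [h1]
    refine cellInner_mono hh.le fun c _ => ?_
    simp only [hq, Pi.mul_apply, Pi.smul_apply, smul_eq_mul]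
    have : 0 ≤ w c ^ 2 * (w c + 3 * φ c) ^ 2 := by positivity
    nlinarith
  have hZle := laplacian_bound_of_energy (a := ε ^ 2) (κ := κ) (Γ := Γ) (K := K) (C := C) (s := s)
    (X := gradNormSq N h μ) (Y := gradNormSq N h w) (W := cellInner N h w w) (V := V) (Z := Z)
    (R := cellInner N h w G) (P := cellInner N h (div h (grad h w)) q)
    (D := cellInner N h (div h (grad h w)) G) (U := faceInner N h (grad h μ) (grad h w))
    (q := cellInner N h q q) (by positivity) hκ0 hC hs hX0 hY0 (cellInner_self_nonneg N hh.le _)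
    (cellInner_self_nonneg N hh.le _) (cellInner_self_nonneg N hh.le _)
    (cellInner_self_nonneg N hh.le _) hΓ.le ?_ ?_ ?_ ?_ ?_ ?_ ?_ ?_ ?_
  · refine Real.abs_le_sqrt ((hsup c hc).trans ?_)
    refine mul_le_mul_of_nonneg_left (hZle.trans ?_) hC.le
    have : s ≤ 1 := hs₁.trans (min_le_left _ _)
    rw [hB₁]
    gcongr
  · have h1 := htest μ
    rw [cellInner_comm, hμ w, hww] at h1
    have h2 := mul_le_mul_of_nonneg_left hgF hs.le
    change _ + 3 / 4 * ε ^ 2 * faceInner N h (grad h w) (grad h w) + _ ≤ _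
    linarith
  · exact (cellInner_sq_le N h w G).trans
      (mul_le_mul_of_nonneg_left hG (cellInner_self_nonneg N hh.le _))
  · rw [htest w]
    have h1 := faceInner_sq_le N hh.le (grad h w) F
    calc (-s * faceInner N h (grad h w) F) ^ 2 = s ^ 2 * faceInner N h (grad h w) F ^ 2 := by ring
      _ ≤ s ^ 2 * (gradNormSq N h w * (κ * gradNormSq N h μ)) := by
          gcongr
          exact h1.trans (mul_le_mul_of_nonneg_left hFF hY0)
      _ = _ := by ring
  · have h1 := hμ (div h (grad h w))
    rw [cellInner_comm, hμw] at h1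
    linarith
  · exact cellInner_sq_le N h _ _
  · exact (cellInner_sq_le N h _ G).trans
      (mul_le_mul_of_nonneg_left hG (cellInner_self_nonneg N hh.le _))
  · exact faceInner_sq_le N hh.le _ _
  · have h1 : 2 * (C * Z) * V + 8 * K ^ 4 * cellInner N h w w
        = h ^ 3 * ∑ c ∈ cells N, (2 * (C * Z) * w c ^ 4 + 8 * K ^ 4 * w c ^ 2) := by
      rw [Finset.sum_add_distrib, ← Finset.mul_sum, ← Finset.mul_sum, hV, cellInner, cellInner]
      have h2 : ∀ c, (w * w) c * (w * w) c = w c ^ 4 := fun c => by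
        simp only [Pi.mul_apply]; ring
      have h3 : ∀ c, w c * w c = w c ^ 2 := fun c => by ring
      simp only [h2, h3]
      ring
    rw [h1, cellInner]
    refine mul_le_mul_of_nonneg_left (Finset.sum_le_sum fun c hc => ?_) (by positivity)
    rw [← sq]
    exact cubic_increment_sq_le (hφ c hc) (hsup c hc)
  · have h1 : s ≤ σ := hs₁.trans (min_le_right _ _)
    rw [hσ, le_div_iff₀ (by positivity)] at h1
    exact h1

/-! ### Sup norm bounds from the error bound -/

lemma abs_avg_le {N : Fin 3 → ℕ} {f : Grid} {K : ℝ} (hf : Neumann N f)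
    (hK : ∀ c ∈ cells N, |f c| ≤ K) {c : Fin 3 → ℤ} (hc : c ∈ cells N) (d : Fin 3) :
    |avg f d c| ≤ K ∧ |avg f d (c - e d)| ≤ K := by
  have h0 := hK c hc
  have hp : |f (c + e d)| ≤ K := by
    by_cases h : c d = N d
    · rw [(hf c hc d).2 h]; exact h0
    · exact hK _ (add_e_mem_cells hc h)
  have hm : |f (c - e d)| ≤ K := by
    by_cases h : c d = 1
    · rw [(hf c hc d).1 h]; exact h0
    · exact hK _ (sub_e_mem_cells hc h)
  rw [abs_le] at h0 hp hm
  simp only [avg, sub_add_cancel, abs_le]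
  constructor <;> constructor <;> linarith

lemma pow_three_mul_card_cells {N : Fin 3 → ℕ} {L : Pt} {h : ℝ} (hN : ∀ d, N d * h = L d) :
    h ^ 3 * ((cells N).card : ℝ) = ∏ d, L d := by
  have : (cells N).card = ∏ d, N d := by
    rw [cells, Pi.card_Icc]
    simp
  rw [this]
  push_cast
  simp only [← hN, Fin.prod_univ_three]
  ring

lemma cellInner_self_le_of_abs_le {N : Fin 3 → ℕ} {L : Pt} {h : ℝ} (hh : 0 ≤ h)
    (hN : ∀ d, N d * h = L d) {f : Grid} {a : ℝ} (hf : ∀ c ∈ cells N, |f c| ≤ a) :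
    cellInner N h f f ≤ a ^ 2 * ∏ d, L d := by
  have : cellInner N h f f ≤ cellInner N h (fun _ => a) (fun _ => a) := by
    refine cellInner_mono hh fun c hc => ?_
    have := hf c hc
    rw [← abs_mul_abs_self]
    gcongr
    exact (abs_nonneg _).trans this
  refine this.trans (le_of_eq ?_)
  rw [← pow_three_mul_card_cells hN]
  simp only [cellInner, Finset.sum_const, nsmul_eq_mul]
  ring

/-- The error bound controls the discrete Laplacian of the error, whatever the ratio of `s` and
`h`: for `s ≤ h` by the inverse inequality, and for `h ≤ s` by interpolation between the gradient
and the gradient of the Laplacian. -/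
lemma cellInner_div_grad_self_le {N : Fin 3 → ℕ} {h s ε E : ℝ} (hh : 0 < h) (hh1 : h ≤ 1)
    (hs : 0 < s) (hs1 : s ≤ 1) (hε : 0 < ε) (hE : 0 ≤ E) {f : Grid} (hf : Neumann N f)
    (h1 : gradNormSq N h f ≤ E * (s ^ 4 + h ^ 4))
    (h2 : ε ^ 2 * s * gradNormSq N h (dlap N h f) ≤ E * (s ^ 4 + h ^ 4)) :
    cellInner N h (div h (grad h f)) (div h (grad h f)) ≤ 24 * E + (1 + 4 * E ^ 2 / ε ^ 2) := by
  set Z := cellInner N h (div h (grad h f)) (div h (grad h f)) with hZ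
  rcases le_total s h with hsh | hsh
  · have h3 : Z ≤ 12 / h ^ 2 * gradNormSq N h f := cellInner_div_self_le N hh (grad h f)
    have h4 : s ^ 4 ≤ h ^ 4 := by gcongr
    have h5 : 0 ≤ 4 * E ^ 2 / ε ^ 2 := by positivity
    calc Z ≤ 12 / h ^ 2 * (E * (h ^ 4 + h ^ 4)) := by
          refine h3.trans (mul_le_mul_of_nonneg_left (h1.trans ?_) (by positivity))
          gcongr
      _ = 24 * E * h ^ 2 := by field_simp; ring
      _ ≤ 24 * E * 1 := by gcongr; exact pow_le_one₀ hh.le hh1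
      _ ≤ _ := by linarith
  · have h3 : Z = -faceInner N h (grad h (dlap N h f)) (grad h f) := by
      rw [← cellInner_div (hf.noFlux_grad h)]
      exact cellInner_congr (fun c hc => (dlap_of_mem hc h f).symm) fun _ _ => rfl
    have h4 : Z ^ 2 ≤ gradNormSq N h (dlap N h f) * gradNormSq N h f := by
      rw [h3, neg_sq]
      exact faceInner_sq_le N hh.le _ _
    have h5 : h ^ 4 ≤ s ^ 4 := by gcongr
    have h6 : E * (s ^ 4 + h ^ 4) ≤ 2 * E * s ^ 4 := by nlinarith
    have h7 : 0 ≤ gradNormSq N h f := faceInner_self_nonneg N hh.le _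
    have h8 : Z ^ 2 ≤ 4 * E ^ 2 / ε ^ 2 := by
      rw [le_div_iff₀ (by positivity)]
      refine le_of_mul_le_mul_right ?_ hs
      calc Z ^ 2 * ε ^ 2 * s
          ≤ (gradNormSq N h (dlap N h f) * gradNormSq N h f) * ε ^ 2 * s := by gcongr
        _ = (ε ^ 2 * s * gradNormSq N h (dlap N h f)) * gradNormSq N h f := by ring
        _ ≤ (2 * E * s ^ 4) * (2 * E * s ^ 4) :=
            mul_le_mul (h2.trans h6) (h1.trans h6) h7 (by positivity)
        _ = 4 * E ^ 2 * (s ^ 7 * s) := by ring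
        _ ≤ 4 * E ^ 2 * (1 * s) := by gcongr; exact pow_le_one₀ hs.le hs1
        _ = _ := by ring
    nlinarith [sq_nonneg (Z - 1)]

section Scheme

variable {N : Fin 3 → ℕ} {h s ε γ : ℝ} {M : ℕ} {φ μ p : ℕ → Grid}

lemma neumann_extrap (hS : IsSchemeSolution N h s ε γ M φ μ p) {m : ℕ} (hm : m ≤ M) :
    Neumann N (extrap φ m) := by
  intro c hc d
  have h1 := hS.bc_phi m hm c hc d
  have h2 := hS.bc_phi (m - 1) (by omega) c hc d
  exact ⟨fun hd => by simp only [extrap, h1.1 hd, h2.1 hd],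
    fun hd => by simp only [extrap, h1.2 hd, h2.2 hd]⟩

/-- The mass equation in flux form. -/
lemma IsSchemeSolution.step_massFlux (hS : IsSchemeSolution N h s ε γ M φ μ p) {m : ℕ}
    (hm1 : 1 ≤ m) (hm : m + 1 ≤ M) {c : Fin 3 → ℤ} (hc : c ∈ cells N) :
    (φ (m + 1) - φ m) c = s * div h (massFlux γ h (avg (extrap φ m)) (μ m) (p m)) c := by
  have hF : massFlux γ h (avg (extrap φ m)) (μ m) (p m)
      = (fun d b => (1 + γ * avg (extrap φ m) d b ^ 2) * grad h (μ m) d b)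
        + fun d b => avg (extrap φ m) d b * grad h (p m) d b := by
    ext d b
    simp only [massFlux, darcyFlux, Pi.add_apply, Pi.mul_apply, Pi.smul_apply, smul_eq_mul]
    ring
  rw [hF, div_add, Pi.add_apply, mul_add]
  exact hS.step m hm1 hm c hc

lemma IsSchemeSolution.sum_cells_eq (hS : IsSchemeSolution N h s ε γ M φ μ p) (hh : h ≠ 0)
    {k : ℕ} (hk1 : 1 ≤ k) (hk : k ≤ M) : ∑ c ∈ cells N, φ k c = ∑ c ∈ cells N, φ 1 c := by
  induction k, hk1 using Nat.le_induction with
  | base => rfl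
  | succ m hm ih =>
    rw [← ih (by omega), ← sub_eq_zero, ← Finset.sum_sub_distrib]
    change ∑ c ∈ cells N, (φ (m + 1) - φ m) c = 0
    rw [Finset.sum_congr rfl fun c hc => hS.step_massFlux hm hk hc, ← Finset.mul_sum,
      sum_div_eq_zero (noFlux_massFlux (hS.bc_mu m hm hk) (hS.bc_p m hm hk)) hh, mul_zero]

/-- The equation for the chemical potential, with the increment `φ^{m+1} - φ^m` split off. -/
lemma IsSchemeSolution.chem_increment (hS : IsSchemeSolution N h s ε γ M φ μ p) {m : ℕ}
    (hm1 : 1 ≤ m) (hm : m + 1 ≤ M) {c : Fin 3 → ℤ} (hc : c ∈ cells N) :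
    μ m c = (φ (m + 1) - φ m) c * ((φ (m + 1) - φ m) c ^ 2 + 4 * φ m c * (φ (m + 1) - φ m) c
        + 6 * φ m c ^ 2) / 4
      - ((fun b => extrap φ m b - φ m b ^ 3) + ε ^ 2 • ((3 / 4 : ℝ) • div h (grad h (φ m))
          + (1 / 4 : ℝ) • div h (grad h (φ (m - 1))))) c
      - 3 / 4 * ε ^ 2 * div h (grad h (φ (m + 1) - φ m)) c := by
  have hlin : (fun b => 3 / 4 * φ (m + 1) b + 1 / 4 * φ (m - 1) b)
      = (3 / 4 : ℝ) • (φ (m + 1) - φ m) + ((3 / 4 : ℝ) • φ m + (1 / 4 : ℝ) • φ (m - 1)) := by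
    ext b
    simp only [Pi.add_apply, Pi.sub_apply, Pi.smul_apply, smul_eq_mul]
    ring
  rw [hS.chem m hm1 hm c hc, dlap_of_mem hc, hlin, grad_add, grad_add, grad_smul, grad_smul,
    grad_smul, div_add, div_add, div_smul, div_smul, div_smul]
  simp only [chi, Pi.add_apply, Pi.sub_apply, Pi.smul_apply, smul_eq_mul]
  ring

/-- A bound for `φ^k` in the sup norm, from bounds for the exact solution and for the discrete
Laplacian of the error. The mean of `φ^k` is that of the initial data. -/
lemma abs_le_of_laplacian_err_le {K C B T : ℝ} {φe : ℝ → Pt → ℝ}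
    (hS : IsSchemeSolution N h s ε γ M φ μ p) (hh : 0 < h) (hs : 0 < s) (hMT : M * s = T)
    (hC : 0 ≤ C)
    (hemb : ∀ f : Grid, Neumann N f → ∑ c ∈ cells N, f c = 0 → ∀ c ∈ cells N,
      f c ^ 2 ≤ C * cellInner N h (div h (grad h f)) (div h (grad h f)))
    (hK : ∀ t ∈ Icc 0 T, ∀ c ∈ cells N, |gridProj N h (φe t) c| ≤ K)
    (hφ1 : ∀ c ∈ cells N, φ 1 c = gridProj N h (φe s) c) {k : ℕ} (hk1 : 1 ≤ k) (hk : k ≤ M)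
    (hB : cellInner N h (div h (grad h (err N h s φe φ k)))
      (div h (grad h (err N h s φe φ k))) ≤ B) :
    ∀ c ∈ cells N, |φ k c| ≤ 3 * K + √(C * B) := by
  intro c hc
  have hmem : ∀ j : ℕ, j ≤ M → (j * s : ℝ) ∈ Icc 0 T := by
    intro j hj
    refine ⟨by positivity, ?_⟩
    rw [← hMT]
    have : (j : ℝ) ≤ M := by exact_mod_cast hj
    gcongr
  have hK1 : ∀ c ∈ cells N, |φ 1 c| ≤ K := by
    intro c hc
    rw [hφ1 c hc]
    simpa using hK _ (hmem 1 (by omega)) c hc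
  set v := err N h s φe φ k with hv
  have hvN : Neumann N v := (neumann_ghostFill N _).sub (hS.bc_phi k hk)
  have hcard : (0 : ℝ) < (cells N).card := by
    exact_mod_cast Finset.card_pos.2 ⟨c, hc⟩
  set a : ℝ := (∑ c ∈ cells N, v c) / (cells N).card with ha
  have hale : |a| ≤ 2 * K := by
    rw [ha, abs_div, abs_of_pos hcard, div_le_iff₀ hcard]
    have h1 : ∑ c ∈ cells N, v c = ∑ c ∈ cells N, (gridProj N h (φe (k * s)) c - φ 1 c) := by
      rw [Finset.sum_sub_distrib, ← hS.sum_cells_eq hh.ne' hk1 hk, ← Finset.sum_sub_distrib]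
      rfl
    rw [h1]
    calc |∑ c ∈ cells N, (gridProj N h (φe (k * s)) c - φ 1 c)|
        ≤ ∑ c ∈ cells N, |gridProj N h (φe (k * s)) c - φ 1 c| :=
          Finset.abs_sum_le_sum_abs _ _
      _ ≤ ∑ _c ∈ cells N, 2 * K := by
          refine Finset.sum_le_sum fun c hc => (abs_sub _ _).trans ?_
          have := hK _ (hmem k hk) c hc
          have := hK1 c hc
          linarith
      _ = 2 * K * (cells N).card := by rw [Finset.sum_const, nsmul_eq_mul]; ring
  have hmean : ∑ c ∈ cells N, (v - (fun _ => a : Grid)) c = 0 := by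
    simp only [Pi.sub_apply, Finset.sum_sub_distrib, Finset.sum_const, nsmul_eq_mul]
    rw [ha]
    field_simp
    ring
  have hgrad : grad h (v - (fun _ => a : Grid)) = grad h v := by
    ext d c; simp [grad]
  have h1 := hemb _ (hvN.sub (neumann_const N a)) hmean c hc
  rw [hgrad] at h1
  have h2 : |v c - a| ≤ √(C * B) :=
    Real.abs_le_sqrt (h1.trans (mul_le_mul_of_nonneg_left hB hC))
  have h3 := hK _ (hmem k hk) c hc
  have h4 : v c = gridProj N h (φe (k * s)) c - φ k c := rfl
  rw [h4] at h2
  rw [abs_le] at *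
  constructor <;> linarith

end Scheme

lemma supNorm_le {N : Fin 3 → ℕ} {f : Grid} {B : ℝ} (hB : 0 ≤ B) (h : ∀ c ∈ cells N, |f c| ≤ B) :
    supNorm N f ≤ B := by
  lift B to ℝ≥0 using hB
  rw [supNorm, NNReal.coe_le_coe]
  exact Finset.sup_le fun c hc => by
    rw [← NNReal.coe_le_coe, coe_nnnorm]
    exact h c hc

lemma growthOne_mono {a b c B : ℝ} (ha : 0 ≤ a) (hb : 0 ≤ b) (hc : 0 ≤ c) (haB : a ≤ B)
    (hbB : b ≤ B) (hcB : c ≤ B) : growthOne a b c ≤ growthOne B B B := by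
  have hB := ha.trans haB
  unfold growthOne
  gcongr

lemma growthTwo_mono {a b c B : ℝ} (ha : 0 ≤ a) (hb : 0 ≤ b) (hc : 0 ≤ c) (haB : a ≤ B)
    (hbB : b ≤ B) (hcB : c ≤ B) : growthTwo a b c ≤ growthTwo B B B := by
  have hB := ha.trans haB
  unfold growthTwo
  gcongr

/-- Under the error bound up to the time step `m`, the numerical solutions `φ^{m-1}`, `φ^m` and
`φ^{m+1}` are bounded in the sup norm, uniformly in the discretisation. -/
theorem exists_supNorm_bound {L : Pt} (hL : ∀ d, 0 < L d) {ε γ T : ℝ} (hε : 0 < ε) (hγ : 0 < γ)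
    (hT : 0 < T) {φe : ℝ → Pt → ℝ} (hreg : RegularityClass L T φe)
    (hbc : ∀ t ∈ Ioc 0 T, NormalDerivZero L (φe t)) {C₃₂ C₃₃ : ℝ} (hC₃₂ : 0 < C₃₂)
    (hC₃₃ : 0 < C₃₃) :
    ∃ s₁ > 0, ∃ B > 0, ∀ (N : Fin 3 → ℕ) (M : ℕ) (h s : ℝ), 0 < h → h ≤ 1 →
      (∀ d, N d * h = L d) → 0 < s → s ≤ s₁ → M * s = T → ∀ φ μ p : ℕ → Grid,
        IsSchemeSolution N h s ε γ M φ μ p →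
        (∀ c ∈ cells N, φ 1 c = gridProj N h (φe s) c) →
        ∀ m : ℕ, 2 ≤ m → m + 1 ≤ M →
          (∀ k : ℕ, 1 ≤ k → k ≤ m → ErrorBound N h s ε C₃₂ C₃₃ φe φ k) →
          supNorm N (φ (m + 1)) ≤ B ∧ supNorm N (φ m) ≤ B ∧ supNorm N (φ (m - 1)) ≤ B := by
  obtain ⟨K, hK0, hK⟩ := exists_bound_gridProj hL hT hreg hbc
  obtain ⟨C, hC, hemb⟩ := exists_sq_le_cellInner_div_grad L hL
  set E : ℝ := C₃₂ * Real.exp (C₃₃ * (T + 1)) with hE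
  have hE0 : 0 < E := by positivity
  set Z : ℝ := 24 * E + (1 + 4 * E ^ 2 / ε ^ 2) with hZ
  set K₁ : ℝ := 3 * K + √(C * Z) with hK₁
  have hK₁0 : 0 < K₁ := by positivity
  have hP : 0 < ∏ d, L d := Finset.prod_pos fun d _ => hL d
  set D : ℝ := 2 * (K ^ 2 * ∏ d, L d) + 2 * Z with hD
  have hD0 : 0 < D := by positivity
  set Γ : ℝ := 2 * ((2 * K₁ + K₁ ^ 3) ^ 2 * ∏ d, L d) + 2 * ((ε ^ 2) ^ 2 * (2 * D)) with hΓ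
  obtain ⟨s₁, hs₁, B, hB⟩ := exists_increment_bound L hL (K := 2 * K₁) (Γ := Γ) hε hγ
    (by positivity) (by positivity)
  refine ⟨min 1 s₁, lt_min one_pos hs₁, K₁ + |B|, by positivity, ?_⟩
  intro N M h s hh hh1 hN hs hss hMT φ μ p hS hφ1 m hm2 hm herr
  have hs1 : s ≤ 1 := hss.trans (min_le_left _ _)
  have hlap : ∀ k, 1 ≤ k → k ≤ m →
      cellInner N h (div h (grad h (err N h s φe φ k))) (div h (grad h (err N h s φe φ k))) ≤ Z := by
    intro k hk1 hk
    have hkT : (k * s : ℝ) ≤ T := by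
      rw [← hMT]
      have : (k : ℝ) ≤ M := by exact_mod_cast (by omega : k ≤ M)
      gcongr
    have hEB : C₃₂ * Real.exp (C₃₃ * (k * s + 1)) * (s ^ 4 + h ^ 4) ≤ E * (s ^ 4 + h ^ 4) := by
      rw [hE]
      gcongr
    have h1 := (herr k hk1 hk).trans hEB
    have h2 : gradNormSq N h (dlap N h (err N h s φe φ k))
        ≤ ∑ j ∈ Finset.Icc 1 k, gradNormSq N h (dlap N h (err N h s φe φ j)) :=
      Finset.single_le_sum (f := fun j => gradNormSq N h (dlap N h (err N h s φe φ j)))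
        (fun j _ => faceInner_self_nonneg N hh.le _) (Finset.mem_Icc.2 ⟨hk1, le_rfl⟩)
    have h3 : 0 ≤ gradNormSq N h (err N h s φe φ k) := faceInner_self_nonneg N hh.le _
    have h4 : 0 ≤ gradNormSq N h (dlap N h (err N h s φe φ k)) := faceInner_self_nonneg N hh.le _
    have h5 := mul_le_mul_of_nonneg_left h2 (by positivity : 0 ≤ ε ^ 2 * s)
    have h6 : 0 ≤ ε ^ 2 * s * gradNormSq N h (dlap N h (err N h s φe φ k)) := by positivity
    exact cellInner_div_grad_self_le hh hh1 hs hs1 hε hE0.le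
      ((neumann_ghostFill N _).sub (hS.bc_phi k (by omega))) (by linarith) (by linarith)
  have hsup : ∀ k, 1 ≤ k → k ≤ m → ∀ c ∈ cells N, |φ k c| ≤ K₁ := fun k hk1 hk =>
    abs_le_of_laplacian_err_le hS hh hs hMT hC.le (hemb N h hh hN)
      (fun t ht c hc => (hK N h hh hN t ht c hc).1) hφ1 hk1 (by omega) (hlap k hk1 hk)
  have hlapφ : ∀ k, 1 ≤ k → k ≤ m →
      cellInner N h (div h (grad h (φ k))) (div h (grad h (φ k))) ≤ D := by
    intro k hk1 hk
    have h1 : div h (grad h (φ k)) = div h (grad h (gridProj N h (φe (k * s))))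
        + (-1 : ℝ) • div h (grad h (err N h s φe φ k)) := by
      have : err N h s φe φ k = gridProj N h (φe (k * s)) - φ k := rfl
      rw [this, grad_sub, div_sub]
      module
    have hkT : (k * s : ℝ) ∈ Icc 0 T := by
      refine ⟨by positivity, ?_⟩
      rw [← hMT]
      have : (k : ℝ) ≤ M := by exact_mod_cast (by omega : k ≤ M)
      gcongr
    rw [h1]
    refine (cellInner_add_self_le N hh.le _ _).trans ?_
    rw [cellInner_smul_self]
    have h2 := cellInner_self_le_of_abs_le hh.le hN fun c hc => (hK N h hh hN _ hkT c hc).2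
    have h3 := hlap k hk1 hk
    rw [hD]
    linarith
  have hφm := hsup m (by omega) le_rfl
  have hφm' := hsup (m - 1) (by omega) (by omega)
  have hextrap : ∀ c ∈ cells N, |extrap φ m c| ≤ 2 * K₁ := by
    intro c hc
    have h1 := hφm c hc
    have h2 := hφm' c hc
    rw [abs_le] at *
    simp only [extrap]
    constructor <;> linarith
  have hG : cellInner N h
      ((fun b => extrap φ m b - φ m b ^ 3) + ε ^ 2 • ((3 / 4 : ℝ) • div h (grad h (φ m))
        + (1 / 4 : ℝ) • div h (grad h (φ (m - 1)))))
      ((fun b => extrap φ m b - φ m b ^ 3) + ε ^ 2 • ((3 / 4 : ℝ) • div h (grad h (φ m))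
        + (1 / 4 : ℝ) • div h (grad h (φ (m - 1))))) ≤ Γ := by
    refine (cellInner_add_self_le N hh.le _ _).trans ?_
    rw [cellInner_smul_self, hΓ]
    have h1 : cellInner N h (fun b => extrap φ m b - φ m b ^ 3)
        (fun b => extrap φ m b - φ m b ^ 3) ≤ (2 * K₁ + K₁ ^ 3) ^ 2 * ∏ d, L d := by
      refine cellInner_self_le_of_abs_le hh.le hN fun c hc => (abs_sub _ _).trans ?_
      rw [abs_pow]
      have := hφm c hc
      gcongr
      exact hextrap c hc
    have h2 := cellInner_add_self_le N hh.le ((3 / 4 : ℝ) • div h (grad h (φ m)))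
      ((1 / 4 : ℝ) • div h (grad h (φ (m - 1))))
    rw [cellInner_smul_self, cellInner_smul_self] at h2
    have h3 := hlapφ m (by omega) le_rfl
    have h4 := hlapφ (m - 1) (by omega) (by omega)
    have h5 : cellInner N h ((3 / 4 : ℝ) • div h (grad h (φ m))
        + (1 / 4 : ℝ) • div h (grad h (φ (m - 1)))) ((3 / 4 : ℝ) • div h (grad h (φ m))
        + (1 / 4 : ℝ) • div h (grad h (φ (m - 1)))) ≤ 2 * D := by linarith
    gcongr
  have hinc := hB N h s hh hN hs (hss.trans (min_le_right _ _)) (avg (extrap φ m))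
    (φ (m + 1) - φ m) (μ m) (p m) (φ m) _
    (fun c hc d => abs_avg_le (neumann_extrap hS (by omega)) hextrap hc d)
    (fun c hc => (hφm c hc).trans (by linarith)) hG
    ((hS.bc_phi _ hm).sub (hS.bc_phi m (by omega))) (hS.bc_mu m (by omega) hm)
    (hS.bc_p m (by omega) hm) (fun c hc => hS.step_massFlux (by omega) hm hc)
    (fun c hc => hS.chem_increment (by omega) hm hc)
    (fun c hc => by rw [← dlap_of_mem hc]; exact hS.pressure m (by omega) hm c hc)
  have hB0 : 0 ≤ K₁ + |B| := by positivity
  refine ⟨supNorm_le hB0 fun c hc => ?_, supNorm_le hB0 fun c hc => ?_,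
    supNorm_le hB0 fun c hc => ?_⟩
  · have h1 := hinc c hc
    have h2 := hφm c hc
    have h3 : φ (m + 1) c = φ m c + (φ (m + 1) - φ m) c := by simp
    rw [h3]
    exact (abs_add_le _ _).trans (add_le_add h2 (h1.trans (le_abs_self B)))
  · linarith [hφm c hc, abs_nonneg B]
  · linarith [hφm' c hc, abs_nonneg B]

end

end CHHS

theorem mainTheorem5
    (L : Fin 3 → ℝ) (hL : ∀ d, 0 < L d)
    (ε γ T : ℝ) (hε : 0 < ε) (hγ : 0 < γ) (hT : 0 < T)
    (φe μe pe : ℝ → (Fin 3 → ℝ) → ℝ) (ue : ℝ → (Fin 3 → ℝ) → Fin 3 → ℝ)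
    (hsol : CHHS.IsCHHSSolution L ε γ T φe μe pe ue)
    (hreg : CHHS.RegularityClass L T φe)
    (C₂₉ C₃₀ C₃₂ C₃₃ : ℝ) (hC₂₉ : 0 < C₂₉) (hC₃₀ : 0 < C₃₀) (hC₃₂ : 0 < C₃₂) (hC₃₃ : 0 < C₃₃) :
    ∃ s₀ > 0, ∃ h₀ > 0,
      ∀ (N : Fin 3 → ℕ) (M : ℕ) (h s : ℝ),
        0 < h → h ≤ h₀ → (∀ d, N d * h = L d) →
        0 < s → s ≤ s₀ → M * s = T →
        ∀ φ μ p : ℕ → CHHS.Grid,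
          CHHS.IsSchemeSolution N h s ε γ M φ μ p →
          (∀ c ∈ CHHS.cells N, φ 0 c = CHHS.gridProj N h (φe 0) c) →
          (∀ c ∈ CHHS.cells N, φ 1 c = CHHS.gridProj N h (φe s) c) →
          ∀ m : ℕ, 2 ≤ m → m + 1 ≤ M →
            (∀ k : ℕ, 1 ≤ k → k ≤ m → CHHS.ErrorBound N h s ε C₃₂ C₃₃ φe φ k) →
            s * (C₂₉ * CHHS.growthOne (CHHS.supNorm N (φ (m + 1))) (CHHS.supNorm N (φ m))
                    (CHHS.supNorm N (φ (m - 1)))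
                + C₃₀ * CHHS.growthTwo (CHHS.supNorm N (φ (m + 1))) (CHHS.supNorm N (φ m))
                    (CHHS.supNorm N (φ (m - 1)))) ≤ 1 / 2 := by
  obtain ⟨s₁, hs₁, B, hB, H⟩ :=
    CHHS.exists_supNorm_bound hL hε hγ hT hreg hsol.bc_phi hC₃₂ hC₃₃
  have hG1 : 0 < CHHS.growthOne B B B := by unfold CHHS.growthOne; positivity
  have hG2 : 0 < CHHS.growthTwo B B B := by unfold CHHS.growthTwo; positivity
  set G := C₂₉ * CHHS.growthOne B B B + C₃₀ * CHHS.growthTwo B B B with hG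
  have hG0 : 0 < G := by positivity
  refine ⟨min s₁ (1 / (2 * G)), lt_min hs₁ (by positivity), 1, one_pos, ?_⟩
  intro N M h s hh hh1 hN hs hss hMT φ μ p hS _ hφ1 m hm2 hm herr
  obtain ⟨h1, h2, h3⟩ :=
    H N M h s hh hh1 hN hs (hss.trans (min_le_left _ _)) hMT φ μ p hS hφ1 m hm2 hm herr
  have hn : ∀ k, 0 ≤ CHHS.supNorm N (φ k) := fun k => NNReal.coe_nonneg _
  have g1 := CHHS.growthOne_mono (hn _) (hn _) (hn _) h1 h2 h3
  have g2 := CHHS.growthTwo_mono (hn _) (hn _) (hn _) h1 h2 h3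
  have hsG := hss.trans (min_le_right _ _)
  calc _ ≤ s * G := by
        rw [hG]
        gcongr
    _ ≤ 1 / (2 * G) * G := by gcongr
    _ = 1 / 2 := by field_simp
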